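/- Let $\mathcal R$ be an o-minimal expansion of the real ordered field $(\mathbb R;+,\cdot,<)$; "definable" means definable in $\mathcal R$ with real parameters. An $\mathcal R$-pfaffian chain (in one variable) on an open interval $I\subseteq\mathbb R$ (possibly $I=\mathbb R$) is a list of functions $f_1,\dots,f_n$ analytic on $I$ for which there are definable functions $p_i:\mathbb R^{i+1}\to\mathbb R$ with $f_i'(x)=p_i(x,f_1(x),\dots,f_i(x))$ for all $x\in I$ and all $i$. Fix a place $t\in\{+\infty,-\infty\}\cup\{p^+,p^-:p\in\mathbb R\}$, where $p^\pm$ denotes right/left-hand neighbourhoods of $p$. For functions $f_1,\dots,f_n$ defined near $t$, let $\mathcal R\langle f_1,\dots,f_n\rangle$ be the definable closure of $\mathbb R\cup\{f_1,\dots,f_n\}$ in the germs at $t$, i.e. the set of germs at $t$ of all $F(f_1,\dots,f_n)$ with $F:\mathbb R^n\to\mathbb R$ definable. A set of germs is independent over $\mathcal R$ if none of its elements is the germ of $F(h_1,\dots,h_k)$ with $F$ definable and $h_1,\dots,h_k$ (germs of) other elements of the set; $\operatorname{trdeg}(A/\mathcal R)$ is the supremum of the cardinalities of independent subsets of a set of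 germs $A$ (o-minimal transcendence degree; for $\mathcal R$ the real ordered field this is the usual transcendence degree over $\mathbb R$). Lemma (minimal pfaffian chains). Let $f_1,\dots,f_n$ be an $\mathcal R$-pfaffian chain on an open interval $I$ that contains a neighbourhood of $t$. (1) Among the $\mathcal R$-pfaffian chains on open intervals that are neighbourhoods of $t$ and that generate the same extension $\mathcal R\langle f_1,\dots,f_n\rangle$ at $t$, there is one of minimal length, and every such chain $g_1,\dots,g_m$ of minimal length satisfies $\operatorname{trdeg}(\mathcal R\langle g_1,\dots,g_m\rangle/\mathcal R)=m$. (2) Among the $\mathcal R$-pfaffian chains on the whole interval $I$ that generate the same extension $\mathcal R\langle f_1,\dots,f_n\rangle$ at $t$, there is one of minimal length, and for every such chain $g_1,\dots,g_m$ of minimal length the functions $g_1,\dots,g_m$ on $I$ generate over $\mathbb R$ an algebra (equivalently a field) of transcendence degree $m$. -/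

import Mathlib

open Filter Topology

universe u v

namespace Pfaff

/-- The `L`-structure on `ℝ` is, up to interdefinability with parameters, an o-minimal expansion of
the ordered field of real numbers: addition, multiplication and order are definable, and every
definable subset of `ℝ` is a finite union of intervals (points, bounded or unbounded intervals).
Throughout, "definable" means definable with parameters from `ℝ`. -/
structure IsOMinimalExpansion (L : FirstOrder.Language.{u, v}) [L.Structure ℝ] : Prop where
  add_definable : (Set.univ : Set ℝ).DefinableFun L (fun x : Fin 2 → ℝ => x 0 + x 1)
  mul_definable : (Set.univ : Set ℝ).DefinableFun L (fun x : Fin 2 → ℝ => x 0 * x 1)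
  lt_definable : (Set.univ : Set ℝ).Definable L {x : Fin 2 → ℝ | x 0 < x 1}
  finite_union_intervals : ∀ s : Set ℝ, (Set.univ : Set ℝ).Definable₁ L s →
    ∃ T : Set (Set ℝ), T.Finite ∧ (∀ J ∈ T, J.OrdConnected) ∧ s = ⋃₀ T

/-- Open intervals of `ℝ`, bounded or not (so `ℝ` itself is one). -/
def IsOpenInterval (I : Set ℝ) : Prop := IsOpen I ∧ I.OrdConnected

/-- The places of the line: `+∞`, `-∞`, `p⁺` and `p⁻` for `p : ℝ`, as filters. -/
def IsPlace (l : Filter ℝ) : Prop :=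
  l = atTop ∨ l = atBot ∨ ∃ p : ℝ, l = 𝓝[>] p ∨ l = 𝓝[<] p

/-- `f 0, …, f (n - 1)` is a pfaffian chain (in one variable) on `I` over the given structure:
the functions are analytic on `I`, and there are definable functions `p i` with
`f i '(x) = p i (x, f 0 x, …, f i x)` on `I`. With `I = univ` the functions are defined on the
whole line. Values outside `I` are irrelevant. -/
def IsPfaffianChainOn (L : FirstOrder.Language.{u, v}) [L.Structure ℝ] (I : Set ℝ) {n : ℕ}
    (f : Fin n → ℝ → ℝ) : Prop :=
  (∀ i, AnalyticOnNhd ℝ (f i) I) ∧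
  ∃ p : (i : Fin n) → (Fin (i.val + 2) → ℝ) → ℝ,
    (∀ i, (Set.univ : Set ℝ).DefinableFun L (p i)) ∧
    ∀ (i : Fin n), ∀ x ∈ I,
      HasDerivAt (f i)
        (p i (Fin.cons x fun j : Fin (i.val + 1) => f (j.castLE i.isLt) x)) x

/-- `f` is a pfaffian chain near the place `l`: it is one on some open interval at `l`. -/
def IsPfaffianChainAt (L : FirstOrder.Language.{u, v}) [L.Structure ℝ] (l : Filter ℝ) {n : ℕ}
    (f : Fin n → ℝ → ℝ) : Prop :=
  ∃ J : Set ℝ, IsOpenInterval J ∧ J ∈ l ∧ IsPfaffianChainOn L J f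

/-- The definable closure, over the given structure on `ℝ`, of a set `S` of germs at `l`: all germs
`F(h₁, …, h_k)` with `F` definable and (the germs of) `h₁, …, h_k` in `S`. -/
def dcl (L : FirstOrder.Language.{u, v}) [L.Structure ℝ] (l : Filter ℝ) (S : Set (Germ l ℝ)) :
    Set (Germ l ℝ) :=
  {a | ∃ (k : ℕ) (F : (Fin k → ℝ) → ℝ) (h : Fin k → ℝ → ℝ),
    (Set.univ : Set ℝ).DefinableFun L F ∧ (∀ i, (h i : Germ l ℝ) ∈ S) ∧
    a = ((fun x => F fun i => h i x : ℝ → ℝ) : Germ l ℝ)}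

/-- The extension generated by the germs at `l` of the functions `f 0, …, f (n - 1)`. -/
def ext (L : FirstOrder.Language.{u, v}) [L.Structure ℝ] (l : Filter ℝ) {n : ℕ}
    (f : Fin n → ℝ → ℝ) : Set (Germ l ℝ) :=
  dcl L l (Set.range fun i => (f i : Germ l ℝ))

/-- A set of germs is independent over the given structure if none of its elements is in the
definable closure of the others. -/
def DclIndep (L : FirstOrder.Language.{u, v}) [L.Structure ℝ] (l : Filter ℝ)
    (B : Set (Germ l ℝ)) : Prop :=
  ∀ b ∈ B, b ∉ dcl L l (B \ {b})

/-- The transcendence degree, with respect to definable closure, of a set of germs: the supremum of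
the cardinalities of its independent subsets. -/
noncomputable def dclTrdeg (L : FirstOrder.Language.{u, v}) [L.Structure ℝ] (l : Filter ℝ)
    (A : Set (Germ l ℝ)) : ℕ∞ :=
  ⨆ B : {B : Set (Germ l ℝ) // B ⊆ A ∧ DclIndep L l B}, B.1.encard

/-- `g` is a pfaffian chain near `l`, and no shorter one generates the same extension. -/
def IsMinimalChainAt (L : FirstOrder.Language.{u, v}) [L.Structure ℝ] (l : Filter ℝ) {m : ℕ}
    (g : Fin m → ℝ → ℝ) : Prop :=
  IsPfaffianChainAt L l g ∧
  ∀ (k : ℕ) (h : Fin k → ℝ → ℝ), IsPfaffianChainAt L l h → ext L l h = ext L l g → m ≤ k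

/-- `g` is a pfaffian chain on `I`, and no shorter one on `I` generates the same extension
at `l`. -/
def IsMinimalChainOn (L : FirstOrder.Language.{u, v}) [L.Structure ℝ] (I : Set ℝ) (l : Filter ℝ)
    {m : ℕ} (g : Fin m → ℝ → ℝ) : Prop :=
  IsPfaffianChainOn L I g ∧
  ∀ (k : ℕ) (h : Fin k → ℝ → ℝ), IsPfaffianChainOn L I h → ext L l h = ext L l g → m ≤ k

end Pfaff

/-! A chain only asks that its right-hand sides be definable. So if one member is a definable
function of `x` and the earlier members, it can be substituted into the later equations and dropped,
with no need to differentiate it (`IsPfaffianChainOn.comp_succAbove`). Shortest chains exist because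
lengths are natural numbers. It remains to show that a failure of independence makes some member
droppable without changing the extension.

For (1), the central fact is that a chain is decided at every place: a definable condition on `(x, f
0 x, …)` eventually holds or eventually fails (`IsPfaffianChainOn.decided`). One equation is added
at a time (`Decided.snoc`). A solution cannot oscillate about a definable function of the earlier
ones, because the sign of the derivative of the difference is decided on a thin strip above zero. A
decided continuous tuple that stays in a definable null set has a component definable from the
preceding ones (`dependent_and_exists_eventually_ncard_eq`). Hence a minimal chain is generic, that
is, it eventually satisfies every definable condition true almost everywhere. Its members are
independent because graphs are null. Any `m + 1` germs of the extension lie in the null image in `ℝ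
^ (m + 1)` of points of differentiability in `ℝ ^ m`, so they are dependent.

Lebesgue measure takes the place of cell decomposition: from the one-variable axiom, definable sets
without interior are null and definable functions are differentiable almost everywhere.

For (2), suppose a member is algebraic over the earlier ones. It is then one of finitely many
definably enumerated roots. The set where it is the `j`-th root is decided at every place, hence
definable by compactness. The member is therefore definable from `x` and the earlier members on all
of `I`, and from the earlier members alone near the place, so it can be dropped. In a minimal chain
each member is thus transcendental over its predecessors. -/

namespace Pfaff

/-! ### Definable predicates and functions -/

section Definability

variable {L : FirstOrder.Language.{u, v}} [L.Structure ℝ]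

variable (L) in
/-- A predicate on tuples of real numbers is definable with real parameters. -/
@[fun_prop]
def DefPred {α : Type} (P : (α → ℝ) → Prop) : Prop :=
  (Set.univ : Set ℝ).Definable L {v | P v}

variable (L) in
/-- A function on tuples of real numbers is definable with real parameters. -/
@[fun_prop]
def DefFn {α : Type} (f : (α → ℝ) → ℝ) : Prop :=
  (Set.univ : Set ℝ).DefinableFun L f

variable {α β : Type} {P Q : (α → ℝ) → Prop} {f g : (α → ℝ) → ℝ}

@[fun_prop]
theorem DefFn.proj (i : α) : DefFn L fun v : α → ℝ => v i :=
  Set.DefinableFun.proj L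

@[fun_prop]
theorem DefFn.const (c : ℝ) : DefFn L fun _ : α → ℝ => c :=
  L.definableFun_const α (Set.mem_univ c)

@[fun_prop]
theorem DefFn.comp [Finite β] {F : (β → ℝ) → ℝ} {g : (α → ℝ) → (β → ℝ)} (hF : DefFn L F)
    (hg : ∀ i, DefFn L fun v => g v i) : DefFn L fun v => F (g v) :=
  Set.DefinableFun.comp hg hF

@[fun_prop]
theorem DefPred.comp [Finite β] {F : (β → ℝ) → Prop} {g : (α → ℝ) → (β → ℝ)} (hF : DefPred L F)
    (hg : ∀ i, DefFn L fun v => g v i) : DefPred L fun v => F (g v) :=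
  Set.Definable.preimage_map (F := g) hg hF

@[fun_prop]
theorem DefPred.and (hP : DefPred L P) (hQ : DefPred L Q) : DefPred L fun v => P v ∧ Q v :=
  Set.Definable.inter hP hQ

@[fun_prop]
theorem DefPred.or (hP : DefPred L P) (hQ : DefPred L Q) : DefPred L fun v => P v ∨ Q v :=
  Set.Definable.union hP hQ

@[fun_prop]
theorem DefPred.not (hP : DefPred L P) : DefPred L fun v => ¬ P v :=
  Set.Definable.compl hP

@[fun_prop]
theorem DefPred.imp (hP : DefPred L P) (hQ : DefPred L Q) : DefPred L fun v => P v → Q v := by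
  simpa only [imp_iff_not_or] using hP.not.or hQ

theorem DefPred.congr (hP : DefPred L P) (h : ∀ v, Q v ↔ P v) : DefPred L Q := by
  rwa [show Q = P from funext fun v => propext (h v)]

theorem DefFn.congr (hf : DefFn L f) (h : ∀ v, g v = f v) : DefFn L g := by
  rwa [show g = f from funext h]

@[fun_prop]
theorem DefPred.const (p : Prop) : DefPred L fun _ : α → ℝ => p := by
  by_cases hp : p
  · simp only [DefPred, hp]
    exact Set.definable_univ
  · simp only [DefPred, hp]
    exact Set.definable_empty

@[fun_prop]
theorem DefPred.exists_tuple [Finite β] {P : (α → ℝ) → (β → ℝ) → Prop}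
    (h : DefPred L fun w : α ⊕ β → ℝ => P (fun i => w (Sum.inl i)) (fun i => w (Sum.inr i))) :
    DefPred L fun v => ∃ y, P v y := by
  simpa [DefPred] using Set.Definable.exists_of_finite h

@[fun_prop]
theorem DefPred.exists_real {P : (α → ℝ) → ℝ → Prop}
    (h : DefPred L fun w : Option α → ℝ => P (fun i => w (some i)) (w none)) :
    DefPred L fun v => ∃ y, P v y := by
  have h' : DefPred L fun v => ∃ y : Unit → ℝ, P v (y ()) :=
    DefPred.exists_tuple
      (Set.Definable.preimage_comp (fun o : Option α => o.elim (Sum.inr ()) Sum.inl) h)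
  refine h'.congr fun v => ⟨fun ⟨y, hy⟩ => ⟨fun _ => y, hy⟩, fun ⟨y, hy⟩ => ⟨y (), hy⟩⟩

@[fun_prop]
theorem DefPred.exists_finite {ι : Type*} [Finite ι] {P : (α → ℝ) → ι → Prop}
    (h : ∀ i, DefPred L fun v => P v i) : DefPred L fun v => ∃ i, P v i := by
  have := Set.definable_iUnion_of_finite (f := fun i => {v | P v i}) h
  simpa [DefPred, Set.ofPred_exists] using this

@[fun_prop]
theorem DefPred.forall_real {P : (α → ℝ) → ℝ → Prop}
    (h : DefPred L fun w : Option α → ℝ => P (fun i => w (some i)) (w none)) :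
    DefPred L fun v => ∀ y, P v y :=
  (DefPred.exists_real (P := fun v y => ¬ P v y) h.not).not.congr fun v => by simp

@[fun_prop]
theorem DefPred.forall_tuple [Finite β] {P : (α → ℝ) → (β → ℝ) → Prop}
    (h : DefPred L fun w : α ⊕ β → ℝ => P (fun i => w (Sum.inl i)) (fun i => w (Sum.inr i))) :
    DefPred L fun v => ∀ y, P v y :=
  (DefPred.exists_tuple (P := fun v y => ¬ P v y) h.not).not.congr fun v => by simp

@[fun_prop]
theorem DefPred.forall_finite {ι : Type*} [Finite ι] {P : (α → ℝ) → ι → Prop}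
    (h : ∀ i, DefPred L fun v => P v i) : DefPred L fun v => ∀ i, P v i :=
  (DefPred.exists_finite fun i => (h i).not).not.congr fun v => by simp

@[fun_prop]
theorem DefPred.eq (hf : DefFn L f) (hg : DefFn L g) : DefPred L fun v => f v = g v :=
  Set.DefinableFun.ofPred_eq hf hg

theorem DefFn.of_graph (h : DefPred L fun w : Option α → ℝ => f (fun i => w (some i)) = w none) :
    DefFn L f := h

open Classical in
@[fun_prop]
theorem DefFn.ite (hP : DefPred L P) (hf : DefFn L f) (hg : DefFn L g) :
    DefFn L fun v => if P v then f v else g v :=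
  Set.DefinableFun.ite hP hf hg

@[fun_prop]
theorem DefFn.snoc {k : ℕ} {g : (α → ℝ) → (Fin k → ℝ)} (hg : ∀ i, DefFn L fun v => g v i)
    (hf : DefFn L f) (i : Fin (k + 1)) :
    DefFn L fun v => (Fin.snoc (g v) (f v) : Fin (k + 1) → ℝ) i := by
  induction i using Fin.lastCases with
  | last => simpa using hf
  | cast i => simpa using hg i

@[fun_prop]
theorem DefFn.insertNth {k : ℕ} {g : (α → ℝ) → (Fin k → ℝ)} (hg : ∀ i, DefFn L fun v => g v i)
    (hf : DefFn L f) (j i : Fin (k + 1)) :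
    DefFn L fun v => (Fin.insertNth j (f v) (g v) : Fin (k + 1) → ℝ) i := by
  rcases Fin.eq_self_or_eq_succAbove j i with rfl | ⟨i, rfl⟩
  · simpa using hf
  · simpa using hg i

@[fun_prop]
theorem DefFn.init {k : ℕ} {g : (α → ℝ) → (Fin (k + 1) → ℝ)} (hg : ∀ i, DefFn L fun v => g v i)
    (i : Fin k) : DefFn L fun v => (Fin.init (g v) : Fin k → ℝ) i :=
  hg i.castSucc

@[fun_prop]
theorem DefFn.update [DecidableEq β] {g : (α → ℝ) → (β → ℝ)} (hg : ∀ i, DefFn L fun v => g v i)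
    (hf : DefFn L f) (j i : β) : DefFn L fun v => Function.update (g v) j (f v) i := by
  by_cases h : i = j
  · subst h; simpa using hf
  · simpa [h] using hg i

@[fun_prop]
theorem DefFn.option_elim {g : (α → ℝ) → (β → ℝ)} (hg : ∀ i, DefFn L fun v => g v i)
    (hf : DefFn L f) (o : Option β) : DefFn L fun v => o.elim (f v) (g v) := by
  cases o with
  | none => exact hf
  | some i => exact hg i

variable [hO : Fact (IsOMinimalExpansion L)]

@[fun_prop]
theorem DefFn.add (hf : DefFn L f) (hg : DefFn L g) : DefFn L fun v => f v + g v :=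
  DefFn.comp (g := fun v => ![f v, g v]) hO.out.add_definable (Fin.forall_fin_two.2 ⟨hf, hg⟩)

@[fun_prop]
theorem DefFn.mul (hf : DefFn L f) (hg : DefFn L g) : DefFn L fun v => f v * g v :=
  DefFn.comp (g := fun v => ![f v, g v]) hO.out.mul_definable (Fin.forall_fin_two.2 ⟨hf, hg⟩)

@[fun_prop]
theorem DefPred.lt (hf : DefFn L f) (hg : DefFn L g) : DefPred L fun v => f v < g v :=
  DefPred.comp (F := fun x : Fin 2 → ℝ => x 0 < x 1) (g := fun v => ![f v, g v])
    hO.out.lt_definable (Fin.forall_fin_two.2 ⟨hf, hg⟩)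

@[fun_prop]
theorem DefPred.le (hf : DefFn L f) (hg : DefFn L g) : DefPred L fun v => f v ≤ g v := by
  simpa only [not_lt] using (DefPred.lt hg hf).not

@[fun_prop]
theorem DefFn.neg (hf : DefFn L f) : DefFn L fun v => -f v :=
  ((DefFn.const (-1)).mul hf).congr fun v => by ring

@[fun_prop]
theorem DefFn.sub (hf : DefFn L f) (hg : DefFn L g) : DefFn L fun v => f v - g v :=
  (hf.add hg.neg).congr fun v => by ring

@[fun_prop]
theorem DefFn.pow (hf : DefFn L f) (n : ℕ) : DefFn L fun v => f v ^ n := by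
  induction n with
  | zero => simpa using DefFn.const 1
  | succ n ih => simpa [pow_succ] using ih.mul hf

@[fun_prop]
theorem DefFn.sum {ι : Type*} (s : Finset ι) {F : ι → (α → ℝ) → ℝ}
    (hF : ∀ i, DefFn L (F i)) : DefFn L fun v => ∑ i ∈ s, F i v := by
  classical
  induction s using Finset.induction_on with
  | empty => simpa using DefFn.const 0
  | insert i s hi ih => simpa [Finset.sum_insert hi] using (hF i).add ih

open Classical in
@[fun_prop]
theorem DefFn.abs (hf : DefFn L f) : DefFn L fun v => |f v| := by
  have : DefFn L fun v => if 0 ≤ f v then f v else -f v := by fun_prop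
  refine this.congr fun v => ?_
  split_ifs with h
  · exact abs_of_nonneg h
  · exact abs_of_neg (not_le.1 h)

/-- Infima of uniformly definable families of sets are definable. -/
theorem DefFn.infimum [Finite α] {P : (α → ℝ) → ℝ → Prop}
    (hP : DefPred L fun w : Option α → ℝ => P (fun i => w (some i)) (w none)) :
    DefFn L fun v => sInf {y | P v y} := by
  obtain ⟨R, hR⟩ : ∃ R : (Option α → ℝ) → Prop, R = fun w => P (fun i => w (some i)) (w none) :=
    ⟨_, rfl⟩
  have hPR : ∀ v y, P v y ↔ R (fun o => o.elim y v) := fun v y => by rw [hR]; rfl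
  rw [← hR] at hP
  simp only [hPR]
  -- The second alternative covers empty sets and sets unbounded below, where `sInf` has the default
  -- value `0`.
  have key : DefPred L fun w : Option α → ℝ =>
      ((∀ y, R (fun o => o.elim y fun i => w (some i)) → w none ≤ y) ∧
        ∀ z, (∀ y, R (fun o => o.elim y fun i => w (some i)) → z ≤ y) → z ≤ w none) ∨
      ((¬ ∃ z, (∀ y, R (fun o => o.elim y fun i => w (some i)) → z ≤ y) ∧
        ∃ y, R (fun o => o.elim y fun i => w (some i))) ∧ w none = 0) := by
    fun_prop
  refine DefFn.of_graph (key.congr fun w => ?_)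
  set S : Set ℝ := {y | R (fun o => o.elim y fun i => w (some i))} with hS
  have e1 : ∀ y, R (fun o => o.elim y fun i => w (some i)) ↔ y ∈ S := fun y => Iff.rfl
  simp only [e1]
  by_cases h : BddBelow S ∧ S.Nonempty
  · have hglb := Real.isGLB_sInf h.2 h.1
    constructor
    · intro h1
      left
      rw [← h1]
      exact ⟨fun y hy => hglb.1 hy, fun z hz => hglb.2 fun y hy => hz y hy⟩
    · rintro (h1 | h1)
      · exact hglb.unique ⟨fun y hy => h1.1 y hy, fun z hz => h1.2 z fun y hy => hz hy⟩
      · exact absurd ⟨h.1.some, fun y hy => h.1.some_mem hy, h.2⟩ h1.1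
  · have h0 : sInf S = 0 := by
      rw [not_and_or] at h
      rcases h with h | h
      · exact Real.sInf_of_not_bddBelow h
      · rw [Set.not_nonempty_iff_eq_empty.1 h, Real.sInf_empty]
    rw [h0]
    constructor
    · intro h1
      refine Or.inr ⟨?_, h1.symm⟩
      rintro ⟨z, hz, y, hy⟩
      exact h ⟨⟨z, fun y hy => hz y hy⟩, y, hy⟩
    · rintro (h1 | h1)
      · rcases not_and_or.1 h with h | h
        · exact absurd ⟨w none, fun y hy => h1.1 y hy⟩ h
        · have := h1.2 (w none + 1) fun y hy => absurd ⟨y, hy⟩ h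
          linarith
      · exact h1.2.symm

/-- Only real quantifiers occur on the right, so differentiability becomes a definable condition. -/
theorem hasDerivAt_iff_forall_abs {φ : ℝ → ℝ} {d x : ℝ} :
    HasDerivAt φ d x ↔ ∀ ε, 0 < ε → ∃ δ, 0 < δ ∧ ∀ t, |t - x| < δ →
      |φ t - φ x - d * (t - x)| ≤ ε * |t - x| := by
  rw [hasDerivAt_iff_isLittleO, Asymptotics.isLittleO_iff]
  simp only [Metric.eventually_nhds_iff, Real.dist_eq, Real.norm_eq_abs, smul_eq_mul]
  refine forall₂_congr fun ε _ => exists_congr fun δ => and_congr Iff.rfl <| forall₂_congr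
    fun t _ => by rw [mul_comm d]

/-- The partial derivative of `h` in the `i`-th variable. -/
noncomputable def partialDeriv {k : ℕ} (h : (Fin k → ℝ) → ℝ) (i : Fin k) (b : Fin k → ℝ) : ℝ :=
  deriv (fun t => h (Function.update b i t)) (b i)

theorem defFn_partialDeriv {k : ℕ} {h : (Fin k → ℝ) → ℝ} (hh : DefFn L h) (i : Fin k) :
    DefFn L (partialDeriv h i) := by
  -- The second alternative records that `deriv` is `0` where there is no derivative.
  have key : DefPred L fun w : Option (Fin k) → ℝ =>
      HasDerivAt (fun t => h (Function.update (fun i => w (some i)) i t)) (w none) (w (some i)) ∨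
      ((¬ ∃ d, HasDerivAt (fun t => h (Function.update (fun i => w (some i)) i t)) d (w (some i)))
        ∧ 0 = w none) := by
    simp only [hasDerivAt_iff_forall_abs]
    fun_prop
  refine DefFn.of_graph (key.congr fun w => ?_)
  rw [partialDeriv]
  by_cases hd : DifferentiableAt ℝ (fun t => h (Function.update (fun i => w (some i)) i t))
      (w (some i))
  · have : ∃ d, HasDerivAt (fun t => h (Function.update (fun i => w (some i)) i t)) d
      (w (some i)) := ⟨_, hd.hasDerivAt⟩
    simp only [this, not_true_eq_false, false_and, or_false]
    exact ⟨fun h1 => h1 ▸ hd.hasDerivAt, fun h1 => h1.deriv⟩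
  · have h1 : ∀ d, ¬ HasDerivAt (fun t => h (Function.update (fun i => w (some i)) i t)) d
      (w (some i)) := fun d h => hd h.differentiableAt
    simp [deriv_zero_of_not_differentiableAt hd, h1]

/-- A first-order form of differentiability: `c` lists the coefficients of the differential, and
letting `M` run over all bounds of the coordinates replaces the sup norm. -/
theorem differentiableAt_iff_forall_abs {k : ℕ} {φ : (Fin k → ℝ) → ℝ} {b : Fin k → ℝ} :
    DifferentiableAt ℝ φ b ↔ ∃ c : Fin k → ℝ, ∀ ε, 0 < ε → ∃ δ, 0 < δ ∧ ∀ b' : Fin k → ℝ,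
      (∀ i, |b' i - b i| < δ) → ∀ M, 0 ≤ M → (∀ i, |b' i - b i| ≤ M) →
        |φ b' - φ b - ∑ i, c i * (b' i - b i)| ≤ ε * M := by
  have hlin : ∀ A : (Fin k → ℝ) →L[ℝ] ℝ, ∀ x, A x = ∑ i, A (Pi.single i 1) * x i := by
    intro A x
    conv_lhs => rw [pi_eq_sum_univ' x, map_sum]
    simp [Pi.single, mul_comm]
  have hiff : ∀ A : (Fin k → ℝ) →L[ℝ] ℝ, HasFDerivAt φ A b ↔
      ∀ ε, 0 < ε → ∃ δ, 0 < δ ∧ ∀ b' : Fin k → ℝ,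
      (∀ i, |b' i - b i| < δ) → ∀ M, 0 ≤ M → (∀ i, |b' i - b i| ≤ M) →
        |φ b' - φ b - A (b' - b)| ≤ ε * M := by
    intro A
    rw [hasFDerivAt_iff_isLittleO, Asymptotics.isLittleO_iff]
    refine forall₂_congr fun ε hε => ?_
    rw [Metric.eventually_nhds_iff]
    refine exists_congr fun δ => and_congr_right fun hδ => forall_congr' fun b' => ?_
    rw [dist_pi_lt_iff hδ]
    refine forall_congr' fun _ => ?_
    rw [Real.norm_eq_abs]
    constructor
    · intro h M hM hb
      exact h.trans (mul_le_mul_of_nonneg_left ((pi_norm_le_iff_of_nonneg hM).2 hb) hε.le)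
    · intro h
      exact h _ (norm_nonneg _) fun i => norm_le_pi_norm (b' - b) i
  constructor
  · rintro ⟨A, hA⟩
    refine ⟨fun i => A (Pi.single i 1), ?_⟩
    have := (hiff A).1 hA
    simpa only [hlin A (_ - b), Pi.sub_apply] using this
  · rintro ⟨c, hc⟩
    refine ⟨∑ i, c i • ContinuousLinearMap.proj i, (hiff _).2 ?_⟩
    simpa [sum_apply] using hc

theorem DefPred.differentiableAt_snoc {k : ℕ} {h : (Fin (k + 1) → ℝ) → ℝ} (hh : DefFn L h) :
    DefPred L fun w : Fin (k + 1) → ℝ =>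
      DifferentiableAt ℝ (fun b : Fin k → ℝ => h (Fin.snoc b (w (Fin.last k)))) (Fin.init w) := by
  simp only [differentiableAt_iff_forall_abs]
  fun_prop

end Definability

/-! ### Places of the line -/

section Places

theorem IsPlace.neBot {l : Filter ℝ} (hl : IsPlace l) : l.NeBot := by
  rcases hl with rfl | rfl | ⟨p, rfl | rfl⟩ <;> infer_instance

/-- The line is traversed towards a place in one direction: either all points nearer to the place
than `a` lie to its left, or all lie to its right. -/
theorem IsPlace.eventually_lt_or_gt {l : Filter ℝ} (hl : IsPlace l) :
    (∀ᶠ a in l, ∀ᶠ y in l, y < a) ∨ (∀ᶠ a in l, ∀ᶠ y in l, a < y) := by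
  rcases hl with rfl | rfl | ⟨p, rfl | rfl⟩
  · exact Or.inr (Eventually.of_forall fun a => eventually_gt_atTop a)
  · exact Or.inl (Eventually.of_forall fun a => eventually_lt_atBot a)
  · left
    filter_upwards [self_mem_nhdsWithin] with a ha
    exact mem_nhdsWithin_of_mem_nhds (Iio_mem_nhds ha)
  · right
    filter_upwards [self_mem_nhdsWithin] with a ha
    exact mem_nhdsWithin_of_mem_nhds (Ioi_mem_nhds ha)

theorem IsPlace.exists_isOpenInterval {l : Filter ℝ} (hl : IsPlace l) {s : Set ℝ} (hs : s ∈ l) :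
    ∃ J, IsOpenInterval J ∧ J ∈ l ∧ J ⊆ s := by
  rcases hl with rfl | rfl | ⟨p, rfl | rfl⟩
  · obtain ⟨a, ha⟩ := mem_atTop_sets.1 hs
    exact ⟨Set.Ioi a, ⟨isOpen_Ioi, Set.ordConnected_Ioi⟩, Ioi_mem_atTop a, fun x hx => ha x hx.le⟩
  · obtain ⟨a, ha⟩ := mem_atBot_sets.1 hs
    exact ⟨Set.Iio a, ⟨isOpen_Iio, Set.ordConnected_Iio⟩, Iio_mem_atBot a, fun x hx => ha x hx.le⟩
  · obtain ⟨a, ha, h⟩ := mem_nhdsGT_iff_exists_Ioo_subset.1 hs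
    exact ⟨Set.Ioo p a, ⟨isOpen_Ioo, Set.ordConnected_Ioo⟩, Ioo_mem_nhdsGT ha, h⟩
  · obtain ⟨a, ha, h⟩ := mem_nhdsLT_iff_exists_Ioo_subset.1 hs
    exact ⟨Set.Ioo a p, ⟨isOpen_Ioo, Set.ordConnected_Ioo⟩, Ioo_mem_nhdsLT ha, h⟩

/-- If `J` is met arbitrarily near the place, every point beyond one point of `J` lies between it
and a still nearer point of `J`. -/
theorem IsPlace.mem_or_compl_mem_of_ordConnected {l : Filter ℝ} (hl : IsPlace l) {J : Set ℝ}
    (hJ : J.OrdConnected) : J ∈ l ∨ Jᶜ ∈ l := by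
  by_cases h : ∃ᶠ x in l, x ∈ J
  · left
    rcases hl.eventually_lt_or_gt with h' | h'
    · obtain ⟨a, haJ, ha⟩ := (h.and_eventually h').exists
      filter_upwards [ha, h'] with x hxa hx
      obtain ⟨b, hbJ, hb⟩ := (h.and_eventually hx).exists
      exact hJ.out hbJ haJ ⟨hb.le, hxa.le⟩
    · obtain ⟨a, haJ, ha⟩ := (h.and_eventually h').exists
      filter_upwards [ha, h'] with x hxa hx
      obtain ⟨b, hbJ, hb⟩ := (h.and_eventually hx).exists
      exact hJ.out haJ hbJ ⟨hxa.le, hb.le⟩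
  · right
    rwa [not_frequently] at h

theorem IsPlace.mem_or_compl_mem_of_sUnion {l : Filter ℝ} (hl : IsPlace l) {T : Set (Set ℝ)}
    (hT : T.Finite) (h : ∀ J ∈ T, J.OrdConnected) : ⋃₀ T ∈ l ∨ (⋃₀ T)ᶜ ∈ l := by
  by_cases h' : ∃ J ∈ T, J ∈ l
  · obtain ⟨J, hJ, hJl⟩ := h'
    exact Or.inl (mem_of_superset hJl (Set.subset_sUnion_of_mem hJ))
  · right
    push Not at h'
    have : ⋂ J ∈ T, Jᶜ ∈ l := (biInter_mem hT).2 fun J hJ =>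
      (hl.mem_or_compl_mem_of_ordConnected (h J hJ)).resolve_left (h' J hJ)
    simpa [Set.compl_sUnion, Set.sInter_image] using this

theorem isPlace_nhdsGT (p : ℝ) : IsPlace (𝓝[>] p) := Or.inr (Or.inr ⟨p, Or.inl rfl⟩)

theorem isPlace_nhdsLT (p : ℝ) : IsPlace (𝓝[<] p) := Or.inr (Or.inr ⟨p, Or.inr rfl⟩)

end Places

/-! ### Definable sets: one variable, measure and genericity -/

section Generic

open MeasureTheory

variable {L : FirstOrder.Language.{u, v}} [L.Structure ℝ] [hO : Fact (IsOMinimalExpansion L)]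

theorem IsPlace.eventually_or_eventually_not {l : Filter ℝ} (hl : IsPlace l) {s : ℝ → Prop}
    (hs : DefPred L fun x : Fin 1 → ℝ => s (x 0)) : (∀ᶠ x in l, s x) ∨ (∀ᶠ x in l, ¬ s x) := by
  obtain ⟨T, hT, hT', h⟩ := hO.out.finite_union_intervals {x | s x} hs
  have := hl.mem_or_compl_mem_of_sUnion hT hT'
  rwa [← h] at this

theorem finite_or_exists_Ioo_subset {s : ℝ → Prop}
    (hs : DefPred L fun x : Fin 1 → ℝ => s (x 0)) :
    {x | s x}.Finite ∨ ∃ p q, p < q ∧ ∀ x ∈ Set.Ioo p q, s x := by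
  obtain ⟨T, hT, hT', h⟩ := hO.out.finite_union_intervals {x | s x} hs
  by_cases hsub : ∀ J ∈ T, J.Subsingleton
  · left
    rw [h]
    exact hT.sUnion fun J hJ => (hsub J hJ).finite
  · right
    push Not at hsub
    obtain ⟨J, hJ, hJ'⟩ := hsub
    obtain ⟨p, hp, q, hq, hpq⟩ := hJ'.exists_lt
    refine ⟨p, q, hpq, fun x hx => ?_⟩
    have : x ∈ {x | s x} := h ▸ ⟨J, hJ, (hT' J hJ).out hp hq ⟨hx.1.le, hx.2.le⟩⟩
    exact this

/-- Rational endpoints leave countably many intervals to consider, so exceptional null sets can be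
united. -/
theorem finite_or_exists_rat_Ioo_subset {s : ℝ → Prop}
    (hs : DefPred L fun x : Fin 1 → ℝ => s (x 0)) :
    {x | s x}.Finite ∨ ∃ p q : ℚ, (p : ℝ) < q ∧ ∀ x ∈ Set.Ioo (p : ℝ) q, s x := by
  refine (finite_or_exists_Ioo_subset hs).imp_right ?_
  rintro ⟨p, q, hpq, h⟩
  obtain ⟨p', hp, hp'⟩ := exists_rat_btwn hpq
  obtain ⟨q', hq, hq'⟩ := exists_rat_btwn hp'
  exact ⟨p', q', hq, fun x hx => h x ⟨hp.trans hx.1, hx.2.trans hq'⟩⟩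

/-- The measurable equivalence splitting off the last coordinate. -/
def snocEquiv (k : ℕ) : (Fin (k + 1) → ℝ) ≃ᵐ (Fin k → ℝ) × ℝ :=
  (MeasurableEquiv.piFinSuccAbove (fun _ => ℝ) (Fin.last k)).trans MeasurableEquiv.prodComm

theorem snocEquiv_apply {k : ℕ} (w : Fin (k + 1) → ℝ) :
    snocEquiv k w = (Fin.init w, w (Fin.last k)) := by
  refine Prod.ext (funext fun i => ?_) rfl
  change w ((Fin.last k).succAbove i) = w i.castSucc
  rw [Fin.succAbove_last]

theorem measurePreserving_snocEquiv (k : ℕ) : MeasurePreserving (snocEquiv k) :=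
  (Measure.measurePreserving_swap).comp
    (volume_preserving_piFinSuccAbove (fun _ : Fin (k + 1) => ℝ) (Fin.last k))

theorem ae_snoc_iff {k : ℕ} {P : (Fin (k + 1) → ℝ) → Prop} (hP : MeasurableSet {w | P w}) :
    (∀ᵐ w, P w) ↔ ∀ᵐ b : Fin k → ℝ, ∀ᵐ y : ℝ, P (Fin.snoc b y) := by
  have hm : MeasurableSet {z : (Fin k → ℝ) × ℝ | P (Fin.snoc z.1 z.2)} := by
    convert (snocEquiv k).symm.measurable hP using 1
    ext z
    obtain ⟨w, rfl⟩ := (snocEquiv k).surjective z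
    simp only [Set.mem_preimage, MeasurableEquiv.symm_apply_apply, Set.mem_ofPred_eq]
    simp [snocEquiv_apply]
  have h2 := Measure.ae_prod_iff_ae_ae (μ := (volume : Measure (Fin k → ℝ)))
    (ν := (volume : Measure ℝ)) hm
  rw [← h2, ← Measure.volume_eq_prod, ← (measurePreserving_snocEquiv k).map_eq,
    ae_map_iff (snocEquiv k).measurable.aemeasurable hm]
  simp [snocEquiv_apply]

theorem ae_snoc_iff' {k : ℕ} {P : (Fin (k + 1) → ℝ) → Prop} (hP : MeasurableSet {w | P w}) :
    (∀ᵐ w, P w) ↔ ∀ᵐ y : ℝ, ∀ᵐ b : Fin k → ℝ, P (Fin.snoc b y) := by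
  rw [ae_snoc_iff hP]
  refine Measure.ae_ae_comm ?_
  convert (snocEquiv k).symm.measurable hP using 1
  ext z
  obtain ⟨w, rfl⟩ := (snocEquiv k).surjective z
  simp only [Set.mem_preimage, MeasurableEquiv.symm_apply_apply, Set.mem_ofPred_eq]
  simp [snocEquiv_apply]

theorem measurable_init {k : ℕ} : Measurable (Fin.init : (Fin (k + 1) → ℝ) → Fin k → ℝ) :=
  measurable_pi_lambda _ fun _ => measurable_pi_apply _

/-- By induction on the dimension. The part `U` interior to vertical fibres is a countable union of
products with rational intervals. The rest `V` has finite, hence closed, fibres, so belonging to it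
can be tested on rational intervals around the last coordinate. In both cases the bases are
definable in one dimension less. -/
theorem DefPred.measurableSet {k : ℕ} {D : (Fin k → ℝ) → Prop} (hD : DefPred L D) :
    MeasurableSet {b | D b} := by
  induction k with
  | zero => exact Subsingleton.measurableSet
  | succ k ih =>
    set U : (Fin (k + 1) → ℝ) → Prop := fun w => ∃ p q, (p < w (Fin.last k) ∧ w (Fin.last k) < q) ∧
      ∀ y, (p < y ∧ y < q) → D (Fin.snoc (Fin.init w) y) with hU
    have hUdef : DefPred L U := by fun_prop
    have hUD : ∀ w, U w → D w := fun w ⟨p, q, h1, h2⟩ => by simpa using h2 _ h1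
    have hUm : MeasurableSet {w | U w} := by
      have : {w | U w} = ⋃ p : ℚ, ⋃ q : ℚ,
          ((Fin.init ⁻¹' {b : Fin k → ℝ | ∀ y, ((p : ℝ) < y ∧ y < q) → D (Fin.snoc b y)}) ∩
            {w : Fin (k + 1) → ℝ | (p : ℝ) < w (Fin.last k) ∧ w (Fin.last k) < q}) := by
        ext w
        simp only [Set.mem_ofPred_eq, Set.mem_iUnion, Set.mem_inter_iff, Set.mem_preimage]
        constructor
        · rintro ⟨p, q, ⟨h1, h2⟩, h3⟩
          obtain ⟨p', hp1, hp2⟩ := exists_rat_btwn h1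
          obtain ⟨q', hq1, hq2⟩ := exists_rat_btwn h2
          exact ⟨p', q', fun y hy => h3 y ⟨hp1.trans hy.1, hy.2.trans hq2⟩, hp2, hq1⟩
        · rintro ⟨p, q, h3, h1, h2⟩
          exact ⟨p, q, ⟨h1, h2⟩, h3⟩
      rw [this]
      refine MeasurableSet.iUnion fun p => MeasurableSet.iUnion fun q => ?_
      refine (measurable_init (ih (by fun_prop))).inter ?_
      exact (measurableSet_lt measurable_const (measurable_pi_apply _)).inter
        (measurableSet_lt (measurable_pi_apply _) measurable_const)
    set V : (Fin (k + 1) → ℝ) → Prop := fun w => D w ∧ ¬ U w with hV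
    have hVdef : DefPred L V := by fun_prop
    have hVfin : ∀ b : Fin k → ℝ, {y | V (Fin.snoc b y)}.Finite := by
      intro b
      refine (finite_or_exists_Ioo_subset (L := L) (s := fun y => V (Fin.snoc b y))
        (by fun_prop)).resolve_right ?_
      rintro ⟨p, q, hpq, h⟩
      obtain ⟨y, hy⟩ := exists_between hpq
      refine (h y hy).2 ⟨p, q, by simpa using hy, fun z hz => ?_⟩
      simpa using (h z hz).1
    have hVm : MeasurableSet {w | V w} := by
      have : {w | V w} = ⋂ p : ℚ, ⋂ q : ℚ,
          ((Fin.init ⁻¹' {b : Fin k → ℝ | ∃ y, ((p : ℝ) < y ∧ y < q) ∧ V (Fin.snoc b y)}) ∪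
            {w : Fin (k + 1) → ℝ | (p : ℝ) < w (Fin.last k) ∧ w (Fin.last k) < q}ᶜ) := by
        ext w
        simp only [Set.mem_ofPred_eq, Set.mem_iInter, Set.mem_union, Set.mem_preimage,
          Set.mem_compl_iff]
        constructor
        · intro hw p q
          by_cases h : (p : ℝ) < w (Fin.last k) ∧ w (Fin.last k) < q
          · exact Or.inl ⟨_, h, by simpa using hw⟩
          · exact Or.inr h
        · intro h
          have hcl : w (Fin.last k) ∈ closure {y | V (Fin.snoc (Fin.init w) y)} := by
            rw [Metric.mem_closure_iff]
            intro ε hε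
            obtain ⟨p, hp1, hp2⟩ := exists_rat_btwn (sub_lt_self (w (Fin.last k)) hε)
            obtain ⟨q, hq1, hq2⟩ := exists_rat_btwn (lt_add_of_pos_right (w (Fin.last k)) hε)
            obtain ⟨y, hy, hVy⟩ := (h p q).resolve_right (not_not.2 ⟨hp2, hq1⟩)
            refine ⟨y, hVy, ?_⟩
            rw [Real.dist_eq, abs_lt]
            constructor <;> linarith [hy.1, hy.2]
          rw [(hVfin (Fin.init w)).isClosed.closure_eq] at hcl
          simpa using hcl
      rw [this]
      refine MeasurableSet.iInter fun p => MeasurableSet.iInter fun q => ?_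
      refine (measurable_init (ih (by fun_prop))).union (MeasurableSet.compl ?_)
      exact (measurableSet_lt measurable_const (measurable_pi_apply _)).inter
        (measurableSet_lt (measurable_pi_apply _) measurable_const)
    convert hUm.union hVm using 1
    ext w
    by_cases h : U w
    · simp [hV, h, hUD w h]
    · simp [hV, h]

/-- A definable set without interior is a null set. -/
theorem DefPred.ae_not_of_interior_eq_empty {k : ℕ} {D : (Fin k → ℝ) → Prop} (hD : DefPred L D)
    (h : ∀ b, ¬ ∀ᶠ b' in 𝓝 b, D b') : ∀ᵐ b, ¬ D b := by
  induction k with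
  | zero =>
    refine Eventually.of_forall fun b hb => h b (Eventually.of_forall fun b' => ?_)
    rwa [Subsingleton.elim b' b]
  | succ k ih =>
    have hm : MeasurableSet {w | ¬ D w} := hD.not.measurableSet
    rw [ae_snoc_iff hm]
    -- The bases of the fibres containing a fixed interval have no interior, since otherwise `D`
    -- would contain a box; by induction they form a null set. Off these countably many null sets
    -- the fibres are finite.
    have key : ∀ p q : ℚ, (p : ℝ) < q →
        ∀ᵐ b : Fin k → ℝ, ¬ ∀ y : ℝ, ((p : ℝ) < y ∧ y < q) → D (Fin.snoc b y) := by
      intro p q hpq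
      refine ih (by fun_prop) fun b hb => ?_
      obtain ⟨y, hy⟩ := exists_between hpq
      refine h (Fin.snoc b y) ?_
      have h1 : Tendsto (fun w : Fin (k + 1) → ℝ => Fin.init w) (𝓝 (Fin.snoc b y)) (𝓝 b) := by
        have : Continuous (fun w : Fin (k + 1) → ℝ => (Fin.init w : Fin k → ℝ)) :=
          continuous_pi fun i => continuous_apply _
        simpa using this.tendsto (Fin.snoc b y)
      have h2 : Tendsto (fun w : Fin (k + 1) → ℝ => w (Fin.last k)) (𝓝 (Fin.snoc b y)) (𝓝 y) := by
        simpa using (continuous_apply (Fin.last k)).tendsto (Fin.snoc b y : Fin (k + 1) → ℝ)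
      filter_upwards [h1.eventually hb, h2.eventually (Ioo_mem_nhds hy.1 hy.2)] with w hw hw'
      simpa using hw _ hw'
    have key' : ∀ᵐ b : Fin k → ℝ, ∀ p q : ℚ, (p : ℝ) < q →
        ¬ ∀ y : ℝ, ((p : ℝ) < y ∧ y < q) → D (Fin.snoc b y) := by
      rw [ae_all_iff]; intro p
      rw [ae_all_iff]; intro q
      rw [eventually_imp_distrib_left]
      exact key p q
    filter_upwards [key'] with b hb
    have hfin : {y | D (Fin.snoc b y)}.Finite := by
      refine (finite_or_exists_rat_Ioo_subset (L := L) (s := fun y => D (Fin.snoc b y))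
        (by fun_prop)).resolve_right ?_
      rintro ⟨p, q, hpq, h⟩
      exact hb p q hpq fun y hy => h y hy
    exact measure_eq_zero_iff_ae_notMem.1 (hfin.measure_zero volume)

theorem eventually_nhds_pi_iff {k : ℕ} {D : (Fin k → ℝ) → Prop} {b : Fin k → ℝ} :
    (∀ᶠ b' in 𝓝 b, D b') ↔ ∃ δ, 0 < δ ∧ ∀ b' : Fin k → ℝ, (∀ i, |b' i - b i| < δ) → D b' := by
  rw [Metric.eventually_nhds_iff]
  refine exists_congr fun δ => and_congr_right fun hδ => forall_congr' fun b' => ?_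
  rw [dist_pi_lt_iff hδ]
  simp only [Real.dist_eq]

theorem DefPred.eventually_nhds {k : ℕ} {D : (Fin k → ℝ) → Prop} (hD : DefPred L D) :
    DefPred L fun b => ∀ᶠ b' in 𝓝 b, D b' := by
  simp only [eventually_nhds_pi_iff]
  fun_prop

/-- The non-interior points of `D` form a definable set, and this set has no interior. -/
theorem DefPred.ae_eventually_of {k : ℕ} {D : (Fin k → ℝ) → Prop} (hD : DefPred L D) :
    ∀ᵐ b, D b → ∀ᶠ b' in 𝓝 b, D b' := by
  have h1 : DefPred L fun b => D b ∧ ¬ ∀ᶠ b' in 𝓝 b, D b' := hD.and hD.eventually_nhds.not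
  filter_upwards [h1.ae_not_of_interior_eq_empty fun b hb =>
    hb.self_of_nhds.2 (hb.mono fun _ h => h.1)] with b hb hDb
  exact not_not.1 fun h => hb ⟨hDb, h⟩

theorem DefPred.ae_eventually {k : ℕ} {D : (Fin k → ℝ) → Prop} (hD : DefPred L D) :
    ∀ᵐ b, (∀ᶠ b' in 𝓝 b, D b') ∨ (∀ᶠ b' in 𝓝 b, ¬ D b') := by
  filter_upwards [hD.ae_eventually_of, hD.not.ae_eventually_of] with b h1 h2
  by_cases h : D b
  · exact Or.inl (h1 h)
  · exact Or.inr (h2 h)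

/-- Continuity is tested on the countably many definable sets `q < F` and `F < q` with `q` rational.
-/
theorem DefFn.ae_continuousAt {k : ℕ} {F : (Fin k → ℝ) → ℝ} (hF : DefFn L F) :
    ∀ᵐ b, ContinuousAt F b := by
  have h1 : ∀ᵐ b, ∀ q : ℚ, (q : ℝ) < F b → ∀ᶠ b' in 𝓝 b, (q : ℝ) < F b' :=
    ae_all_iff.2 fun q => DefPred.ae_eventually_of (L := L) (by fun_prop)
  have h2 : ∀ᵐ b, ∀ q : ℚ, F b < (q : ℝ) → ∀ᶠ b' in 𝓝 b, F b' < (q : ℝ) :=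
    ae_all_iff.2 fun q => DefPred.ae_eventually_of (L := L) (by fun_prop)
  filter_upwards [h1, h2] with b h1 h2
  refine tendsto_order.2 ⟨fun a ha => ?_, fun a ha => ?_⟩
  · obtain ⟨q, hq, hq'⟩ := exists_rat_btwn ha
    exact (h1 q hq').mono fun _ h => hq.trans h
  · obtain ⟨q, hq, hq'⟩ := exists_rat_btwn ha
    exact (h2 q hq).mono fun _ h => h.trans hq'

end Generic

/-! ### Almost everywhere differentiability of definable functions -/

section Differentiability

open MeasureTheory

variable {L : FirstOrder.Language.{u, v}} [L.Structure ℝ] [hO : Fact (IsOMinimalExpansion L)]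

theorem ae_fin_one_iff {P : ℝ → Prop} : (∀ᵐ x : Fin 1 → ℝ, P (x 0)) ↔ ∀ᵐ t, P t := by
  rw [← (volume_preserving_funUnique (Fin 1) ℝ).map_eq,
    (MeasurableEquiv.funUnique (Fin 1) ℝ).measurableEmbedding.ae_map_iff]
  rfl

theorem eventually_nhds_of_fin_one {P : (Fin 1 → ℝ) → Prop} {x : Fin 1 → ℝ}
    (h : ∀ᶠ x' in 𝓝 x, P x') : ∀ᶠ t in 𝓝 (x 0), P fun _ => t := by
  have : Tendsto (fun (t : ℝ) (_ : Fin 1) => t) (𝓝 (x 0)) (𝓝 x) := by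
    have hc : Continuous (fun (t : ℝ) (_ : Fin 1) => t) := continuous_pi fun _ => continuous_id
    convert hc.tendsto (x 0)
  exact this.eventually h

/-- Continuous induction: the points of `[u, w]` where `g` is at least `g u` form a closed set,
which extends to the right of each of its points. -/
theorem monotoneOn_Ioo_of_continuous {g : ℝ → ℝ} {c d : ℝ}
    (hc : ∀ t ∈ Set.Ioo c d, ContinuousAt g t)
    (hA : ∀ t ∈ Set.Ioo c d, ∃ ε, 0 < ε ∧ ∀ s, t < s → s < t + ε → g t ≤ g s) :
    MonotoneOn g (Set.Ioo c d) := by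
  intro u hu w hw huw
  have hsub : Set.Icc u w ⊆ Set.Ioo c d := fun x hx => ⟨hu.1.trans_le hx.1, hx.2.trans_lt hw.2⟩
  have hcl : IsClosed ({x | g u ≤ g x} ∩ Set.Icc u w) := by
    have : ContinuousOn g (Set.Icc u w) := fun x hx => (hc x (hsub hx)).continuousWithinAt
    have := this.preimage_isClosed_of_isClosed isClosed_Icc (isClosed_Ici (a := g u))
    rwa [Set.inter_comm] at this
  refine hcl.mem_of_ge_of_forall_exists_gt (le_refl (g u)) huw ?_
  rintro x ⟨hx, hx1, hx2⟩
  obtain ⟨ε, hε, h⟩ := hA x (hsub ⟨hx1, hx2.le⟩)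
  obtain ⟨y, hy, hy'⟩ := exists_between (lt_min hx2 (lt_add_of_pos_right x hε))
  exact ⟨y, le_trans hx (h y hy (hy'.trans_le (min_le_right _ _))), hy,
    (hy'.trans_le (min_le_left _ _)).le⟩

theorem continuousAt_iff_forall_abs {k : ℕ} {F : (Fin k → ℝ) → ℝ} {b : Fin k → ℝ} :
    ContinuousAt F b ↔ ∀ ε, 0 < ε → ∃ δ, 0 < δ ∧ ∀ b' : Fin k → ℝ, (∀ i, |b' i - b i| < δ) →
      |F b' - F b| < ε := by
  rw [ContinuousAt, Metric.tendsto_nhds]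
  refine forall₂_congr fun ε _ => ?_
  rw [eventually_nhds_pi_iff]
  simp only [Real.dist_eq]

theorem DefPred.continuousAt {k : ℕ} {F : (Fin k → ℝ) → ℝ} (hF : DefFn L F) :
    DefPred L fun b => ContinuousAt F b := by
  simp only [continuousAt_iff_forall_abs]
  fun_prop

/-- A definable function of one variable is locally monotone or antitone almost everywhere. -/
theorem DefFn.ae_exists_monotoneOn {g : ℝ → ℝ} (hg : DefFn L fun x : Fin 1 → ℝ => g (x 0)) :
    ∀ᵐ t, ∃ s ∈ 𝓝 t, MonotoneOn g s ∨ AntitoneOn g s := by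
  obtain ⟨G, hG⟩ : ∃ G : (Fin 1 → ℝ) → ℝ, G = fun x => g (x 0) := ⟨_, rfl⟩
  have hgG : ∀ t, g t = G fun _ => t := fun t => by rw [hG]
  rw [← hG] at hg
  -- At every point o-minimality gives one of two behaviours just to the right: `g` stays at or
  -- above its value there, or at or below. Each is a definable condition, so almost everywhere it
  -- persists in a neighbourhood.
  have hA := DefPred.ae_eventually_of (L := L) (k := 1) (D := fun x => ∃ ε, 0 < ε ∧
    ∀ s, x 0 < s → s < x 0 + ε → G (fun _ => x 0) ≤ G fun _ => s) (by fun_prop)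
  have hB := DefPred.ae_eventually_of (L := L) (k := 1) (D := fun x => ∃ ε, 0 < ε ∧
    ∀ s, x 0 < s → s < x 0 + ε → G (fun _ => s) ≤ G fun _ => x 0) (by fun_prop)
  have hC : ∀ᵐ x : Fin 1 → ℝ, ∀ᶠ x' in 𝓝 x, ContinuousAt G x' := by
    filter_upwards [hg.ae_continuousAt, (DefPred.continuousAt hg).ae_eventually_of] with x h1 h2
    exact h2 h1
  rw [← ae_fin_one_iff]
  filter_upwards [hA, hB, hC] with x hA hB hC
  have hC' : ∀ᶠ t in 𝓝 (x 0), ContinuousAt g t := by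
    filter_upwards [eventually_nhds_of_fin_one hC] with t ht
    have hc : Continuous (fun (t : ℝ) (_ : Fin 1) => t) := continuous_pi fun _ => continuous_id
    have := ContinuousAt.comp (f := fun (t : ℝ) (_ : Fin 1) => t) ht hc.continuousAt
    rw [show g = G ∘ fun (t : ℝ) (_ : Fin 1) => t from funext hgG]
    exact this
  have hdec := (isPlace_nhdsGT (x 0)).eventually_or_eventually_not (L := L)
    (s := fun s => G (fun _ => x 0) ≤ G fun _ => s) (by fun_prop)
  have hloc : ∀ P : ℝ → Prop, (∀ᶠ t in 𝓝[>] (x 0), P t) →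
      ∃ ε, 0 < ε ∧ ∀ s, x 0 < s → s < x 0 + ε → P s := by
    intro P hP
    obtain ⟨y, hy, h⟩ := mem_nhdsGT_iff_exists_Ioo_subset.1 hP
    exact ⟨y - x 0, sub_pos.2 hy, fun s h1 h2 => h ⟨h1, by linarith⟩⟩
  rcases hdec with h | h
  · have h1 := hC'.and (eventually_nhds_of_fin_one (hA (hloc _ h)))
    obtain ⟨c, d, hcd, h2⟩ := mem_nhds_iff_exists_Ioo_subset.1 h1
    refine ⟨_, Ioo_mem_nhds hcd.1 hcd.2, Or.inl ?_⟩
    refine monotoneOn_Ioo_of_continuous (fun t ht => (h2 ht).1) fun t ht => ?_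
    simpa only [hgG] using (h2 ht).2
  · have h1 := hC'.and (eventually_nhds_of_fin_one (hB (hloc _ (h.mono fun _ h => (not_le.1 h).le))))
    obtain ⟨c, d, hcd, h2⟩ := mem_nhds_iff_exists_Ioo_subset.1 h1
    refine ⟨_, Ioo_mem_nhds hcd.1 hcd.2, Or.inr ?_⟩
    have : MonotoneOn (fun t => -g t) (Set.Ioo c d) := by
      refine monotoneOn_Ioo_of_continuous (fun t ht => (h2 ht).1.neg) fun t ht => ?_
      simpa only [hgG, neg_le_neg_iff] using (h2 ht).2
    exact fun u hu w hw huw => neg_le_neg_iff.1 (this hu hw huw)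

/-- If the definable set of points without derivative had interior, `g` would be monotone or
antitone on some interval inside it, against Lebesgue's theorem on monotone functions. -/
theorem DefFn.ae_differentiableAt_real {g : ℝ → ℝ} (hg : DefFn L fun x : Fin 1 → ℝ => g (x 0)) :
    ∀ᵐ t, DifferentiableAt ℝ g t := by
  have hmono := hg.ae_exists_monotoneOn
  obtain ⟨G, hG⟩ : ∃ G : (Fin 1 → ℝ) → ℝ, G = fun x => g (x 0) := ⟨_, rfl⟩
  have hgG : g = fun t => G fun _ => t := funext fun t => by rw [hG]
  rw [← hG] at hg
  have hdef : DefPred L fun x : Fin 1 → ℝ => ¬ ∃ d, HasDerivAt (fun t => G fun _ => t) d (x 0) := by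
    simp only [hasDerivAt_iff_forall_abs]
    fun_prop
  have hnd := hdef.ae_not_of_interior_eq_empty ?_
  · rw [← ae_fin_one_iff]
    filter_upwards [hnd] with x hx
    obtain ⟨d, hd⟩ := not_not.1 hx
    rw [hgG]
    exact hd.differentiableAt
  · intro x hx
    have hx' := eventually_nhds_of_fin_one hx
    simp only [← hgG] at hx'
    have hx'' : ∃ᶠ t in ae volume, (∀ᶠ t' in 𝓝 t, ¬ ∃ d, HasDerivAt g d t') := by
      intro h
      have := measure_eq_zero_iff_ae_notMem.2 h
      exact (isOpen_setOfPred_eventually_nhds.measure_pos volume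
        ⟨_, hx'.eventually_nhds.self_of_nhds⟩).ne' this
    obtain ⟨t, ht, s, hs, hmt⟩ := (hx''.and_eventually hmono).exists
    obtain ⟨c, d, htcd, hcd⟩ := mem_nhds_iff_exists_Ioo_subset.1 (inter_mem hs ht)
    have hae : ∀ᵐ r, r ∈ Set.Ioo c d → DifferentiableWithinAt ℝ g (Set.Ioo c d) r := by
      rcases hmt with hmt | hmt
      · exact (hmt.mono fun r hr => (hcd hr).1).ae_differentiableWithinAt_of_mem
      · have := ((hmt.mono (s₂ := Set.Ioo c d) fun r hr => (hcd hr).1).neg).ae_differentiableWithinAt_of_mem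
        filter_upwards [this] with r hr hr'
        simpa using (hr hr').neg
    have hae' : ∀ᵐ r, r ∉ Set.Ioo c d := by
      filter_upwards [hae] with r hr hr'
      exact (hcd hr').2 ⟨_, ((hr hr').differentiableAt (Ioo_mem_nhds hr'.1 hr'.2)).hasDerivAt⟩
    exact (isOpen_Ioo.measure_pos volume ⟨t, htcd⟩).ne' (measure_eq_zero_iff_ae_notMem.2 hae')

theorem hasFDerivAt_sum_partialDeriv {k : ℕ} {h : (Fin k → ℝ) → ℝ} {b : Fin k → ℝ}
    (hd : DifferentiableAt ℝ h b) :
    HasFDerivAt h ((∑ i, partialDeriv h i b •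
      ContinuousLinearMap.proj (R := ℝ) (φ := fun _ => ℝ) i) : (Fin k → ℝ) →L[ℝ] ℝ) b := by
  have hpd : ∀ i, fderiv ℝ h b (Pi.single i 1) = partialDeriv h i b := by
    intro i
    have h2 : HasDerivAt (Function.update b i) (Pi.single i 1) (b i) := hasDerivAt_update b i (b i)
    have h3 := HasFDerivAt.comp_hasDerivAt (b i) (l := h) (l' := fderiv ℝ h b)
      (by rw [Function.update_eq_self]; exact hd.hasFDerivAt) h2
    exact h3.deriv.symm
  have hL : fderiv ℝ h b = (∑ i, partialDeriv h i b •
      ContinuousLinearMap.proj (R := ℝ) (φ := fun _ => ℝ) i : (Fin k → ℝ) →L[ℝ] ℝ) := by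
    refine ContinuousLinearMap.ext fun x => ?_
    have hx : fderiv ℝ h b x = ∑ i, x i * fderiv ℝ h b (Pi.single i 1) := by
      conv_lhs => rw [pi_eq_sum_univ' x, map_sum]
      exact Finset.sum_congr rfl fun i _ => by rw [map_smul, smul_eq_mul]
    rw [hx]
    simp [sum_apply, hpd, mul_comm]
  rw [← hL]
  exact hd.hasFDerivAt

/-- A definable function is differentiable almost everywhere. -/
theorem DefFn.ae_differentiableAt {k : ℕ} {h : (Fin k → ℝ) → ℝ} (hh : DefFn L h) :
    ∀ᵐ b, DifferentiableAt ℝ h b := by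
  induction k with
  | zero => exact Eventually.of_forall fun b => (hasFDerivAt_of_subsingleton h b).differentiableAt
  | succ k ih =>
    -- The C¹ criterion. The partial differentials in the first `k` variables and in the last one
    -- exist almost everywhere, by induction and the one-variable case. They therefore exist near
    -- almost every point, and their coefficients are continuous almost everywhere.
    have h1d : DefPred L fun w : Fin (k + 1) → ℝ =>
        DifferentiableAt ℝ (fun b : Fin k → ℝ => h (Fin.snoc b (w (Fin.last k)))) (Fin.init w) :=
      .differentiableAt_snoc hh
    have h1 : ∀ᵐ w : Fin (k + 1) → ℝ,
        DifferentiableAt ℝ (fun b : Fin k → ℝ => h (Fin.snoc b (w (Fin.last k)))) (Fin.init w) := by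
      rw [ae_snoc_iff' h1d.measurableSet]
      refine Eventually.of_forall fun y => ?_
      simpa using ih (h := fun b => h (Fin.snoc b y)) (by fun_prop)
    have h2d : DefPred L fun w : Fin (k + 1) → ℝ =>
        ∃ d, HasDerivAt (fun y => h (Fin.snoc (Fin.init w : Fin k → ℝ) y)) d (w (Fin.last k)) := by
      simp only [hasDerivAt_iff_forall_abs]
      fun_prop
    have h2 : ∀ᵐ w : Fin (k + 1) → ℝ, 
        ∃ d, HasDerivAt (fun y => h (Fin.snoc (Fin.init w : Fin k → ℝ) y)) d (w (Fin.last k)) := by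
      rw [ae_snoc_iff h2d.measurableSet]
      refine Eventually.of_forall fun b => ?_
      have := DefFn.ae_differentiableAt_real (L := L) (g := fun y => h (Fin.snoc b y))
        (by fun_prop)
      filter_upwards [this] with y hy
      rw [Fin.init_snoc, Fin.snoc_last]
      exact ⟨_, hy.hasDerivAt⟩
    have h3 : ∀ᵐ w, ∀ i, ContinuousAt (partialDeriv h i) w :=
      ae_all_iff.2 fun i => (defFn_partialDeriv hh i).ae_continuousAt
    filter_upwards [h1, h1d.ae_eventually_of, h2, h2d.ae_eventually_of, h3]
      with w h1 h1' h2 h2' h3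
    replace h1' := h1' h1
    replace h2' := h2' h2
    have hsnoc : Continuous fun z : (Fin k → ℝ) × ℝ => (Fin.snoc z.1 z.2 : Fin (k + 1) → ℝ) := by
      refine continuous_pi fun i => ?_
      induction i using Fin.lastCases with
      | last => simpa using continuous_snd
      | cast i =>
        simp only [Fin.snoc_castSucc]
        exact (continuous_apply i).comp continuous_fst
    have hs : Tendsto (fun z : (Fin k → ℝ) × ℝ => (Fin.snoc z.1 z.2 : Fin (k + 1) → ℝ))
        (𝓝 (Fin.init w, w (Fin.last k))) (𝓝 w) := by
      simpa using hsnoc.tendsto (Fin.init w, w (Fin.last k))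
    have hpd : ∀ (b : Fin k → ℝ) (y : ℝ) (i : Fin k), partialDeriv (fun b => h (Fin.snoc b y)) i b =
        partialDeriv h i.castSucc (Fin.snoc b y) := by
      intro b y i
      simp only [partialDeriv, Fin.snoc_castSucc, Fin.snoc_update]
    have hpl : ∀ (b : Fin k → ℝ) (y : ℝ), deriv (fun y => h (Fin.snoc b y)) y =
        partialDeriv h (Fin.last k) (Fin.snoc b y) := by
      intro b y
      simp only [partialDeriv, Fin.snoc_last, Fin.update_snoc_last]
    have key := hasStrictFDerivAt_uncurry_coprod (𝕜 := ℝ)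
      (u := ((Fin.init w : Fin k → ℝ), w (Fin.last k))) (f := fun b y => h (Fin.snoc b y))
      (f₁ := fun b y => ∑ i : Fin k, partialDeriv h i.castSucc (Fin.snoc b y) •
        (ContinuousLinearMap.proj (R := ℝ) (φ := fun _ => ℝ) i))
      (f₂ := fun b y => partialDeriv h (Fin.last k) (Fin.snoc b y) • ContinuousLinearMap.id ℝ ℝ)
      ?_ ?_ ?_ ?_
    · have h4 := key.hasFDerivAt.differentiableAt
      have h5 : DifferentiableAt ℝ (fun w : Fin (k + 1) → ℝ => ((Fin.init w : Fin k → ℝ),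
          w (Fin.last k))) w := by
        refine DifferentiableAt.prodMk ?_ (differentiableAt_apply _ _)
        exact differentiableAt_pi.2 fun i => differentiableAt_apply _ _
      have h6 := DifferentiableAt.comp w h4 h5
      refine h6.congr_of_eventuallyEq (Eventually.of_forall fun w' => ?_)
      change h w' = h (Fin.snoc (Fin.init w') (w' (Fin.last k)))
      rw [Fin.snoc_init_self]
    · filter_upwards [hs.eventually h1'] with z hz
      simp only [Fin.snoc_last, Fin.init_snoc] at hz
      have := hasFDerivAt_sum_partialDeriv hz
      simp only [hpd] at this
      exact this
    · filter_upwards [hs.eventually h2'] with z hz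
      simp only [Fin.snoc_last, Fin.init_snoc] at hz
      obtain ⟨d, hd⟩ := hz
      rw [← hd.deriv, hpl] at hd
      refine hd.hasFDerivAt.congr_fderiv ?_
      refine ContinuousLinearMap.ext fun x => ?_
      change x * _ = _ * x
      rw [mul_comm]
    · have hc : Tendsto (fun z : (Fin k → ℝ) × ℝ => (∑ i : Fin k,
          partialDeriv h i.castSucc (Fin.snoc z.1 z.2) •
          (ContinuousLinearMap.proj (R := ℝ) (φ := fun _ => ℝ) i) : (Fin k → ℝ) →L[ℝ] ℝ))
          (𝓝 (Fin.init w, w (Fin.last k))) (𝓝 (∑ i : Fin k,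
          partialDeriv h i.castSucc (Fin.snoc (Fin.init w : Fin k → ℝ) (w (Fin.last k))) •
          (ContinuousLinearMap.proj (R := ℝ) (φ := fun _ => ℝ) i))) := by
        rw [Fin.snoc_init_self]
        exact tendsto_finsetSum _ fun i _ => ((h3 i.castSucc).tendsto.comp hs).smul_const _
      exact hc
    · have hc : Tendsto (fun z : (Fin k → ℝ) × ℝ =>
          partialDeriv h (Fin.last k) (Fin.snoc z.1 z.2) • ContinuousLinearMap.id ℝ ℝ)
          (𝓝 (Fin.init w, w (Fin.last k)))
          (𝓝 (partialDeriv h (Fin.last k) (Fin.snoc (Fin.init w : Fin k → ℝ) (w (Fin.last k))) •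
            ContinuousLinearMap.id ℝ ℝ)) := by
        rw [Fin.snoc_init_self]
        exact ((h3 (Fin.last k)).tendsto.comp hs).smul_const _
      exact hc

end Differentiability

/-! ### Enumerating finite sets of reals in a definable way -/

section Enumeration

/-- Remove the least element of a set of reals. -/
def peelSet (F : Set ℝ) : Set ℝ := {y | y ∈ F ∧ ∃ z, z < y ∧ z ∈ F}

theorem peelSet_eq {F : Set ℝ} (hF : F.Finite) (hne : F.Nonempty) : peelSet F = F \ {sInf F} := by
  ext y
  have hmem := hne.csInf_mem hF
  constructor
  · rintro ⟨hy, z, hz, hzF⟩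
    exact ⟨hy, fun h => absurd (csInf_le hF.bddBelow hzF) (not_le.2 (by rwa [← h]))⟩
  · rintro ⟨hy, hy'⟩
    exact ⟨hy, _, lt_of_le_of_ne (csInf_le hF.bddBelow hy) (Ne.symm hy'), hmem⟩

theorem peelSet_subset (F : Set ℝ) : peelSet F ⊆ F := fun _ h => h.1

theorem ncard_peelSet {F : Set ℝ} (hF : F.Finite) : (peelSet F).ncard = F.ncard - 1 := by
  rcases F.eq_empty_or_nonempty with rfl | hne
  · simp [peelSet]
  · rw [peelSet_eq hF hne, Set.ncard_sdiff_singleton_of_mem (hne.csInf_mem hF)]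

theorem iterate_peelSet_nonempty_iff {F : Set ℝ} (hF : F.Finite) (j : ℕ) :
    (peelSet^[j] F).Nonempty ↔ j < F.ncard := by
  induction j generalizing F with
  | zero => exact (Set.ncard_pos hF).symm
  | succ j ih =>
    rw [Function.iterate_succ_apply, ih (hF.subset (peelSet_subset F)), ncard_peelSet hF]
    omega

/-- Removing the minimum repeatedly lists the set in increasing order. Peeling and infima are
first-order, so the listing is definable in families. -/
theorem mem_iff_exists_sInf_iterate_peelSet {F : Set ℝ} (hF : F.Finite) (y : ℝ) :
    y ∈ F ↔ ∃ j < F.ncard, y = sInf (peelSet^[j] F) := by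
  induction hn : F.ncard generalizing F with
  | zero => simp [(Set.ncard_eq_zero hF).1 hn]
  | succ n ih =>
    have hne : F.Nonempty := (Set.ncard_pos hF).1 (by omega)
    have hn' : (peelSet F).ncard = n := by rw [ncard_peelSet hF, hn]; rfl
    have ih' := ih (hF.subset (peelSet_subset F)) hn'
    rw [peelSet_eq hF hne] at ih'
    constructor
    · intro hy
      by_cases h : y = sInf F
      · exact ⟨0, by omega, h⟩
      · obtain ⟨j, hj, hj'⟩ := ih'.1 ⟨hy, h⟩
        refine ⟨j + 1, by omega, ?_⟩
        rwa [Function.iterate_succ_apply, peelSet_eq hF hne]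
    · rintro ⟨j, hj, rfl⟩
      cases j with
      | zero => exact hne.csInf_mem hF
      | succ j =>
        refine (ih'.2 ⟨j, by omega, ?_⟩).1
        rw [Function.iterate_succ_apply, peelSet_eq hF hne]

theorem sInf_iterate_peelSet_lt {F : Set ℝ} (hF : F.Finite) {i j : ℕ} (hij : i < j)
    (hj : j < F.ncard) : sInf (peelSet^[i] F) < sInf (peelSet^[j] F) := by
  induction i generalizing F j with
  | zero =>
    obtain ⟨j, rfl⟩ : ∃ j', j = j' + 1 := ⟨j - 1, by omega⟩
    have hne : F.Nonempty := (Set.ncard_pos hF).1 (by omega)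
    have hF' := hF.subset (peelSet_subset F)
    have h1 : sInf (peelSet^[j] (peelSet F)) ∈ peelSet F :=
      (mem_iff_exists_sInf_iterate_peelSet hF' _).2
        ⟨j, by rw [ncard_peelSet hF]; omega, rfl⟩
    rw [Function.iterate_succ_apply]
    obtain ⟨z, hz, hzF⟩ := h1.2
    exact (csInf_le hF.bddBelow hzF).trans_lt hz
  | succ i ih =>
    obtain ⟨j, rfl⟩ : ∃ j', j = j' + 1 := ⟨j - 1, by omega⟩
    rw [Function.iterate_succ_apply, Function.iterate_succ_apply]
    exact ih (hF.subset (peelSet_subset F)) (by omega) (by rw [ncard_peelSet hF]; omega)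

theorem ncard_eq_of_forall_existsUnique {A B : Set ℝ} {r : ℝ → ℝ → Prop}
    (h1 : ∀ y ∈ A, ∃ z, (z ∈ B ∧ r y z) ∧ ∀ z', z' ∈ B ∧ r y z' → z' = z)
    (h2 : ∀ z ∈ B, ∃ y, (y ∈ A ∧ r y z) ∧ ∀ y', y' ∈ A ∧ r y' z → y' = y) :
    A.ncard = B.ncard := by
  choose! f hf hf' using h1
  refine Set.ncard_congr (fun y _ => f y) (fun y hy => (hf y hy).1) (fun y y' hy hy' h => ?_)
    fun z hz => ?_
  · obtain ⟨w, -, hw⟩ := h2 (f y) (hf y hy).1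
    rw [hw y ⟨hy, (hf y hy).2⟩, hw y' ⟨hy', h ▸ (hf y' hy').2⟩]
  · obtain ⟨y, hy, -⟩ := h2 z hz
    exact ⟨y, hy.1, (hf' y hy.1 z ⟨hz, hy.2⟩).symm⟩

end Enumeration

/-! ### Definable families of finite sets along decided tuples -/

section Decided

open MeasureTheory

variable {L : FirstOrder.Language.{u, v}} [L.Structure ℝ] {k : ℕ} {l : Filter ℝ}
  {a : ℝ → Fin k → ℝ}

variable (L) in
/-- Every definable condition holds eventually along the tuple, or eventually fails. -/
def Decided (l : Filter ℝ) (a : ℝ → Fin k → ℝ) : Prop :=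
  ∀ D : (Fin k → ℝ) → Prop, DefPred L D → (∀ᶠ x in l, D (a x)) ∨ (∀ᶠ x in l, ¬ D (a x))

variable (L) in
/-- Some component of the tuple is eventually a definable function of the preceding ones. -/
def Dependent (l : Filter ℝ) (a : ℝ → Fin k → ℝ) : Prop :=
  ∃ (i : Fin k) (F : (Fin i.val → ℝ) → ℝ), DefFn L F ∧
    ∀ᶠ x in l, a x i = F fun j => a x (j.castLE i.isLt.le)

theorem Decided.map {m : ℕ} (ha : Decided L l a) {Φ : (Fin k → ℝ) → Fin m → ℝ}
    (hΦ : ∀ i, DefFn L fun b => Φ b i) : Decided L l fun x => Φ (a x) :=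
  fun D hD => ha (fun b => D (Φ b)) (hD.comp hΦ)

theorem exists_eq_comp_succAbove {a : ℝ → Fin (k + 1) → ℝ} (i : Fin (k + 1))
    {F : (Fin i.val → ℝ) → ℝ} (hF : DefFn L F)
    (h : ∀ᶠ x in l, a x i = F fun j => a x (j.castLE i.isLt.le)) :
    ∃ Ψ : (Fin k → ℝ) → Fin (k + 1) → ℝ, (∀ j, DefFn L fun b => Ψ b j) ∧
      ∀ᶠ x in l, a x = Ψ fun j => a x (i.succAbove j) := by
  refine ⟨fun c => Fin.insertNth i (F fun j => c ⟨j, by omega⟩) c, fun j => by fun_prop, ?_⟩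
  filter_upwards [h] with x hx
  symm
  rw [Fin.insertNth_eq_iff]
  refine ⟨?_, rfl⟩
  rw [hx]
  congr 1
  ext j
  congr 1
  rw [Fin.succAbove_of_castSucc_lt]
  · rfl
  · exact j.2

variable [hO : Fact (IsOMinimalExpansion L)]

/-- The fibre over `b` of a subset of `ℝ ^ (k + 1)`. -/
def fiber (D : (Fin (k + 1) → ℝ) → Prop) (b : Fin k → ℝ) : Set ℝ := {y | D (Fin.snoc b y)}

/-- Remove the least element of every fibre. -/
def peel (D : (Fin (k + 1) → ℝ) → Prop) (w : Fin (k + 1) → ℝ) : Prop :=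
  D w ∧ ∃ z, z < w (Fin.last k) ∧ D (Fin.snoc (Fin.init w) z)

theorem DefPred.iterate_peel {D : (Fin (k + 1) → ℝ) → Prop} (hD : DefPred L D) (j : ℕ) :
    DefPred L (peel^[j] D) := by
  induction j generalizing D with
  | zero => exact hD
  | succ j ih =>
    rw [Function.iterate_succ_apply]
    refine ih ?_
    unfold peel
    fun_prop

theorem fiber_iterate_peel (D : (Fin (k + 1) → ℝ) → Prop) (j : ℕ) (b : Fin k → ℝ) :
    fiber (peel^[j] D) b = peelSet^[j] (fiber D b) := by
  induction j generalizing D with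
  | zero => rfl
  | succ j ih =>
    rw [Function.iterate_succ_apply, Function.iterate_succ_apply, ih]
    congr 1
    ext y
    simp [fiber, peel, peelSet]

/-- The `j`-th element of the fibre over `b`. -/
noncomputable def nthFiber (D : (Fin (k + 1) → ℝ) → Prop) (j : ℕ) (b : Fin k → ℝ) : ℝ :=
  sInf (fiber (peel^[j] D) b)

theorem defFn_nthFiber {D : (Fin (k + 1) → ℝ) → Prop} (hD : DefPred L D) (j : ℕ) :
    DefFn L (nthFiber D j) := by
  have := hD.iterate_peel j
  exact DefFn.infimum (P := fun b y => (peel^[j] D) (Fin.snoc b y)) (by fun_prop)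

theorem mem_fiber_iff {D : (Fin (k + 1) → ℝ) → Prop} {b : Fin k → ℝ} (hF : (fiber D b).Finite)
    (y : ℝ) : y ∈ fiber D b ↔ ∃ j < (fiber D b).ncard, y = nthFiber D j b := by
  simp only [nthFiber, fiber_iterate_peel]
  exact mem_iff_exists_sInf_iterate_peelSet hF y

theorem nthFiber_inj {D : (Fin (k + 1) → ℝ) → Prop} {b : Fin k → ℝ} (hF : (fiber D b).Finite)
    {i j : ℕ} (hi : i < (fiber D b).ncard) (hj : j < (fiber D b).ncard)
    (h : nthFiber D i b = nthFiber D j b) : i = j := by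
  simp only [nthFiber, fiber_iterate_peel] at h
  rcases lt_trichotomy i j with hij | hij | hij
  · exact absurd h (sInf_iterate_peelSet_lt hF hij hj).ne
  · exact hij
  · exact absurd h (sInf_iterate_peelSet_lt hF hij hi).ne'

/-- The fibres of `D` near `b` are in bijection with the fibre over `b`, corresponding points being
close to each other. -/
def IsStablePoint (D : (Fin (k + 1) → ℝ) → Prop) (b : Fin k → ℝ) : Prop :=
  ∃ ε, 0 < ε ∧ ∃ δ, 0 < δ ∧ ∀ b' : Fin k → ℝ, (∀ i, |b' i - b i| < δ) →
    (∀ y, D (Fin.snoc b y) → ∃ z, (D (Fin.snoc b' z) ∧ |z - y| < ε) ∧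
      ∀ z', D (Fin.snoc b' z') ∧ |z' - y| < ε → z' = z) ∧
    (∀ z, D (Fin.snoc b' z) → ∃ y, (D (Fin.snoc b y) ∧ |z - y| < ε) ∧
      ∀ y', D (Fin.snoc b y') ∧ |z - y'| < ε → y' = y)

theorem DefPred.isStablePoint {D : (Fin (k + 1) → ℝ) → Prop} (hD : DefPred L D) :
    DefPred L (IsStablePoint D) := by
  unfold IsStablePoint
  fun_prop

theorem IsStablePoint.eventually_ncard_eq {D : (Fin (k + 1) → ℝ) → Prop} {b : Fin k → ℝ}
    (h : IsStablePoint D b) : ∀ᶠ b' in 𝓝 b, (fiber D b').ncard = (fiber D b).ncard := by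
  obtain ⟨ε, hε, h⟩ := h
  filter_upwards [eventually_nhds_pi_iff.2 h] with b' hb'
  exact (ncard_eq_of_forall_existsUnique (r := fun y z => |z - y| < ε) hb'.1 hb'.2).symm

/-- At almost every `b` the enumerating functions are continuous and each condition "more than `j`
points" is locally constant. The number of points is then constant near `b`, and points of equal
rank stay close. -/
theorem ae_isStablePoint {D : (Fin (k + 1) → ℝ) → Prop} (hD : DefPred L D)
    (hF : ∀ b, (fiber D b).Finite) : ∀ᵐ b, IsStablePoint D b := by
  have h1 : ∀ᵐ b, ∀ j, ContinuousAt (nthFiber D j) b :=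
    ae_all_iff.2 fun j => (defFn_nthFiber hD j).ae_continuousAt
  have h2 : ∀ᵐ b, ∀ j, (∀ᶠ b' in 𝓝 b, ∃ y, (peel^[j] D) (Fin.snoc b' y)) ∨
      (∀ᶠ b' in 𝓝 b, ¬ ∃ y, (peel^[j] D) (Fin.snoc b' y)) := by
    refine ae_all_iff.2 fun j => DefPred.ae_eventually (L := L) ?_
    have := hD.iterate_peel j
    fun_prop
  have hne : ∀ b j, (∃ y, (peel^[j] D) (Fin.snoc b y)) ↔ j < (fiber D b).ncard := by
    intro b j
    rw [← iterate_peelSet_nonempty_iff (hF b), ← fiber_iterate_peel]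
    rfl
  filter_upwards [h1, h2] with b h1 h2
  simp only [hne] at h2
  set N := (fiber D b).ncard with hN
  have hcard : ∀ᶠ b' in 𝓝 b, (fiber D b').ncard = N := by
    have h3 : ∀ᶠ b' in 𝓝 b, ∀ j ∈ Finset.range N, j < (fiber D b').ncard := by
      rw [Filter.eventually_all_finset]
      intro j hj
      exact (h2 j).resolve_right fun h => h.self_of_nhds (Finset.mem_range.1 hj)
    have h4 : ∀ᶠ b' in 𝓝 b, ¬ N < (fiber D b').ncard :=
      (h2 N).resolve_left fun h => lt_irrefl _ h.self_of_nhds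
    filter_upwards [h3, h4] with b' h3 h4
    refine le_antisymm (not_lt.1 h4) (not_lt.1 fun h => ?_)
    exact lt_irrefl _ (h3 _ (Finset.mem_range.2 h))
  -- Distinct points over `b` are at least `2 * ε` apart, so a point that moves by less than `ε` is
  -- within `ε` of one of them only.
  obtain ⟨ε, hε, hsep⟩ : ∃ ε, 0 < ε ∧ ∀ i ∈ Finset.range N, ∀ j ∈ Finset.range N,
      |nthFiber D i b - nthFiber D j b| < 2 * ε → i = j := by
    have : ∀ᶠ ε in 𝓝[>] (0 : ℝ), ∀ i ∈ Finset.range N, ∀ j ∈ Finset.range N,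
        |nthFiber D i b - nthFiber D j b| < 2 * ε → i = j := by
      rw [Filter.eventually_all_finset]; intro i hi
      rw [Filter.eventually_all_finset]; intro j hj
      by_cases hij : i = j
      · exact Eventually.of_forall fun _ _ => hij
      · have hpos : 0 < |nthFiber D i b - nthFiber D j b| / 2 := by
          refine half_pos (abs_pos.2 (sub_ne_zero.2 fun h => hij ?_))
          exact nthFiber_inj (hF b) (Finset.mem_range.1 hi) (Finset.mem_range.1 hj) h
        filter_upwards [mem_nhdsWithin_of_mem_nhds (Iio_mem_nhds hpos)] with ε hε h
        rw [Set.mem_Iio] at hε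
        linarith
    obtain ⟨ε, h, hε⟩ := (this.and self_mem_nhdsWithin).exists
    exact ⟨ε, hε, h⟩
  refine ⟨ε, hε, eventually_nhds_pi_iff.1 ?_⟩
  have hclose : ∀ᶠ b' in 𝓝 b, ∀ j ∈ Finset.range N, |nthFiber D j b' - nthFiber D j b| < ε := by
    rw [Filter.eventually_all_finset]
    intro j _
    exact (Metric.tendsto_nhds.1 (h1 j) ε hε).mono fun b' h => by rwa [Real.dist_eq] at h
  filter_upwards [hcard, hclose] with b' hcard hclose
  have hmem : ∀ y, D (Fin.snoc b y) ↔ ∃ j < N, y = nthFiber D j b := mem_fiber_iff (hF b)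
  have hmem' : ∀ y, D (Fin.snoc b' y) ↔ ∃ j < N, y = nthFiber D j b' := by
    rw [← hcard]
    exact mem_fiber_iff (hF b')
  have key : ∀ i < N, ∀ j < N, |nthFiber D i b' - nthFiber D j b| < ε → i = j := by
    intro i hi j hj h
    refine hsep i (Finset.mem_range.2 hi) j (Finset.mem_range.2 hj) ?_
    have h1 := hclose i (Finset.mem_range.2 hi)
    rw [abs_lt] at *
    constructor <;> linarith [h.1, h.2, h1.1, h1.2]
  simp only [hmem, hmem']
  constructor
  · rintro _ ⟨j, hj, rfl⟩
    refine ⟨_, ⟨⟨j, hj, rfl⟩, hclose j (Finset.mem_range.2 hj)⟩, ?_⟩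
    rintro _ ⟨⟨i, hi, rfl⟩, h⟩
    rw [key i hi j hj h]
  · rintro _ ⟨j, hj, rfl⟩
    refine ⟨_, ⟨⟨j, hj, rfl⟩, hclose j (Finset.mem_range.2 hj)⟩, ?_⟩
    rintro _ ⟨⟨i, hi, rfl⟩, h⟩
    rw [key j hj i hi h]

/-- Along a continuous path of stable points the cardinality is locally constant, and an interval is
connected. -/
theorem exists_eventually_ncard_eq_of_isStablePoint (hl : IsPlace l)
    (hc : ∀ᶠ x in l, ContinuousAt a x) {D : (Fin (k + 1) → ℝ) → Prop}
    (hs : ∀ᶠ x in l, IsStablePoint D (a x)) : ∃ N, ∀ᶠ x in l, (fiber D (a x)).ncard = N := by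
  obtain ⟨J, hJ, hJl, hJs⟩ := hl.exists_isOpenInterval (hc.and hs)
  have := hl.neBot
  obtain ⟨x₀, hx₀⟩ := nonempty_of_mem hJl
  refine ⟨(fiber D (a x₀)).ncard, ?_⟩
  filter_upwards [hJl] with x hx
  refine hJ.2.isPreconnected.constant (f := fun x => (fiber D (a x)).ncard) ?_ hx hx₀
  intro x hx
  refine ContinuousAt.continuousWithinAt ?_
  have := (hJs hx).1.eventually (hJs hx).2.eventually_ncard_eq
  exact tendsto_nhds_of_eventually_eq this

/-- The two assertions are proved together by induction on `k`; the second stands in for uniform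
finiteness. First assertion: by Fubini, the bases `T` whose fibre in `S` contains an interval are
null. If the initial part of the tuple stays in `T`, induction applies. If not, the tuple lies in a
set with finite fibres of eventually constant cardinality `N`, and decidedness identifies the last
component with one of `N` enumerating functions. Second assertion: the unstable points are null, so
either the tuple runs through stable points, or it is dependent and a component can be dropped. -/
theorem dependent_and_exists_eventually_ncard_eq (hl : IsPlace l) (k : ℕ) :
    (∀ a : ℝ → Fin k → ℝ, Decided L l a → (∀ᶠ x in l, ContinuousAt a x) →
      ∀ S : (Fin k → ℝ) → Prop, DefPred L S → (∀ᵐ b, ¬ S b) → (∀ᶠ x in l, S (a x)) →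
        Dependent L l a) ∧
    (∀ a : ℝ → Fin k → ℝ, Decided L l a → (∀ᶠ x in l, ContinuousAt a x) →
      ∀ D : (Fin (k + 1) → ℝ) → Prop, DefPred L D → (∀ b, (fiber D b).Finite) →
        ∃ N, ∀ᶠ x in l, (fiber D (a x)).ncard = N) := by
  have := hl.neBot
  have finish : ∀ k, (∀ a : ℝ → Fin k → ℝ, Decided L l a → (∀ᶠ x in l, ContinuousAt a x) →
      ∀ S : (Fin k → ℝ) → Prop, DefPred L S → (∀ᵐ b, ¬ S b) → (∀ᶠ x in l, S (a x)) →
        Dependent L l a) → (∀ a : ℝ → Fin k → ℝ, Decided L l a → (∀ᶠ x in l, ContinuousAt a x) →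
      ∀ D : (Fin (k + 1) → ℝ) → Prop, DefPred L D → (∀ b, (fiber D b).Finite) →
        Dependent L l a ∨ ∃ N, ∀ᶠ x in l, (fiber D (a x)).ncard = N) := by
    intro k hk a ha hc D hD hF
    rcases ha _ hD.isStablePoint with h | h
    · exact Or.inr (exists_eventually_ncard_eq_of_isStablePoint hl hc h)
    · refine Or.inl (hk a ha hc _ hD.isStablePoint.not ?_ h)
      filter_upwards [ae_isStablePoint hD hF] with b hb
      exact not_not.2 hb
  induction k with
  | zero =>
    have h0 : ∀ a : ℝ → Fin 0 → ℝ, Decided L l a → (∀ᶠ x in l, ContinuousAt a x) →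
      ∀ S : (Fin 0 → ℝ) → Prop, DefPred L S → (∀ᵐ b, ¬ S b) → (∀ᶠ x in l, S (a x)) →
        Dependent L l a := by
      intro a _ _ S _ hS h
      obtain ⟨x, hx⟩ := h.exists
      obtain ⟨b, hb⟩ := hS.exists
      exact absurd (Subsingleton.elim (a x) b ▸ hx) hb
    refine ⟨h0, fun a ha hc D hD hF => (finish 0 h0 a ha hc D hD hF).resolve_left ?_⟩
    rintro ⟨i, -⟩
    exact i.elim0
  | succ k ih =>
    have hdep : ∀ a : ℝ → Fin (k + 1) → ℝ, Decided L l a → (∀ᶠ x in l, ContinuousAt a x) →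
      ∀ S : (Fin (k + 1) → ℝ) → Prop, DefPred L S → (∀ᵐ b, ¬ S b) → (∀ᶠ x in l, S (a x)) →
        Dependent L l a := by
      intro a ha hc S hS hS0 hSa
      have ha' : Decided L l fun x => (Fin.init (a x) : Fin k → ℝ) := ha.map fun i => by fun_prop
      have hc' : ∀ᶠ x in l, ContinuousAt (fun x => (Fin.init (a x) : Fin k → ℝ)) x := by
        filter_upwards [hc] with x hx
        exact tendsto_pi_nhds.2 fun i => (continuousAt_pi.1 hx) i.castSucc
      set T : (Fin k → ℝ) → Prop := fun b => ∃ p q, p < q ∧ ∀ y, p < y ∧ y < q → S (Fin.snoc b y)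
        with hT
      have hTdef : DefPred L T := by fun_prop
      have hT0 : ∀ᵐ b, ¬ T b := by
        filter_upwards [(ae_snoc_iff hS.not.measurableSet).1 hS0] with b hb
        rintro ⟨p, q, hpq, h⟩
        refine (isOpen_Ioo.measure_pos volume (Set.nonempty_Ioo.2 hpq)).ne'
          (measure_mono_null (t := {y | ¬ ¬ S (Fin.snoc b y)}) (fun y hy => ?_) hb)
        exact not_not.2 (h y hy)
      rcases ha' T hTdef with h | h
      · obtain ⟨i, F, hF, h⟩ := ih.1 _ ha' hc' T hTdef hT0 h
        exact ⟨i.castSucc, F, hF, h⟩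
      · set D : (Fin (k + 1) → ℝ) → Prop := fun w => S w ∧ ¬ T (Fin.init w) with hD
        have hDdef : DefPred L D := by fun_prop
        have hDF : ∀ b, (fiber D b).Finite := by
          intro b
          refine (finite_or_exists_Ioo_subset (L := L) (s := fun y => D (Fin.snoc b y))
            (by fun_prop)).resolve_right ?_
          rintro ⟨p, q, hpq, h⟩
          obtain ⟨y, hy⟩ := exists_between hpq
          have h1 := (h y hy).2
          rw [Fin.init_snoc] at h1
          exact h1 ⟨p, q, hpq, fun z hz => (h z hz).1⟩
        obtain ⟨N, hN⟩ := ih.2 _ ha' hc' D hDdef hDF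
        by_contra hcon
        have hnot : ∀ j ∈ Finset.range N,
            ∀ᶠ x in l, ¬ a x (Fin.last k) = nthFiber D j (Fin.init (a x)) := by
          intro j _
          have := defFn_nthFiber hDdef j
          refine (ha (fun w => w (Fin.last k) = nthFiber D j (Fin.init w))
            (by fun_prop)).resolve_left fun h => hcon ?_
          exact ⟨Fin.last k, nthFiber D j, this, h⟩
        rw [← Filter.eventually_all_finset] at hnot
        obtain ⟨x, ⟨hxN, hx⟩, hx', hx''⟩ := ((hN.and hnot).and (hSa.and h)).exists
        have hmem : a x (Fin.last k) ∈ fiber D (Fin.init (a x)) := by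
          change D _
          rw [Fin.snoc_init_self]
          exact ⟨hx', hx''⟩
        obtain ⟨j, hj, hj'⟩ := (mem_fiber_iff (hDF _) _).1 hmem
        exact hx j (Finset.mem_range.2 (hxN ▸ hj)) hj'
    refine ⟨hdep, fun a ha hc D hD hF => ?_⟩
    rcases finish _ hdep a ha hc D hD hF with h | h
    · obtain ⟨i, F, hF', h⟩ := h
      obtain ⟨Ψ, hΨ, h⟩ := exists_eq_comp_succAbove i hF' h
      have ha' : Decided L l fun x j => a x (i.succAbove j) :=
        ha.map (Φ := fun b j => b (i.succAbove j)) fun j => by fun_prop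
      have hc' : ∀ᶠ x in l, ContinuousAt (fun x j => a x (i.succAbove j)) x := by
        filter_upwards [hc] with x hx
        exact tendsto_pi_nhds.2 fun j => (continuousAt_pi.1 hx) (i.succAbove j)
      have hfib : ∀ c, fiber (fun w => D (Fin.snoc (Ψ (Fin.init w)) (w (Fin.last k)))) c =
          fiber D (Ψ c) := fun c => by simp [fiber]
      obtain ⟨N, hN⟩ := ih.2 _ ha' hc'
        (fun w => D (Fin.snoc (Ψ (Fin.init w)) (w (Fin.last k)))) (by fun_prop)
        fun c => by rw [hfib]; exact hF _
      refine ⟨N, ?_⟩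
      filter_upwards [h, hN] with x hx hxN
      rw [hfib] at hxN
      rw [hx]
      exact hxN
    · exact h

end Decided

/-! ### Definable differential equations over decided tuples -/

section Hardy

open MeasureTheory

variable {L : FirstOrder.Language.{u, v}} [L.Structure ℝ] {k : ℕ} {l : Filter ℝ}
  {a : ℝ → Fin k → ℝ}

variable (L) in
/-- The tuple eventually satisfies every definable condition that holds almost everywhere. -/
def Generic (l : Filter ℝ) (a : ℝ → Fin k → ℝ) : Prop :=
  ∀ S : (Fin k → ℝ) → Prop, DefPred L S → (∀ᵐ b, S b) → ∀ᶠ x in l, S (a x)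

theorem IsPlace.eventually_eventually_nhds (hl : IsPlace l) {P : ℝ → Prop} (h : ∀ᶠ x in l, P x) :
    ∀ᶠ x in l, ∀ᶠ x' in 𝓝 x, P x' := by
  obtain ⟨J, hJ, hJl, hJP⟩ := hl.exists_isOpenInterval h
  filter_upwards [hJl] with x hx
  filter_upwards [hJ.1.mem_nhds hx] with x' hx'
  exact hJP hx'

variable [hO : Fact (IsOMinimalExpansion L)]

theorem Decided.generic_or_dependent (hl : IsPlace l) (ha : Decided L l a)
    (hc : ∀ᶠ x in l, ContinuousAt a x) : Generic L l a ∨ Dependent L l a := by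
  by_contra! h
  refine h.1 fun S hS hS0 => (ha S hS).resolve_right fun h' => h.2 ?_
  exact (dependent_and_exists_eventually_ncard_eq hl k).1 a ha hc _ hS.not
    (hS0.mono fun b hb => not_not.2 hb) h'

/-- A decided tuple is definable from a generic subtuple. -/
theorem Decided.exists_generic (hl : IsPlace l) (ha : Decided L l a)
    (hc : ∀ᶠ x in l, ContinuousAt a x) : ∃ (m : ℕ) (σ : Fin m → Fin k)
      (Ψ : (Fin m → ℝ) → Fin k → ℝ), (∀ i, DefFn L fun b => Ψ b i) ∧
      Generic L l (fun x j => a x (σ j)) ∧ ∀ᶠ x in l, a x = Ψ fun j => a x (σ j) := by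
  induction k with
  | zero =>
    refine ⟨0, Fin.elim0, fun _ => Fin.elim0, fun i => i.elim0, ?_,
      Eventually.of_forall fun x => Subsingleton.elim _ _⟩
    refine (ha.generic_or_dependent hl hc).elim (fun h => ?_) fun ⟨i, _⟩ => i.elim0
    convert h
  | succ k ih =>
    rcases ha.generic_or_dependent hl hc with h | h
    · exact ⟨k + 1, id, id, fun i => DefFn.proj i, h, Eventually.of_forall fun x => rfl⟩
    · obtain ⟨i, F, hF, h⟩ := h
      obtain ⟨Ψ, hΨ, h⟩ := exists_eq_comp_succAbove i hF h
      obtain ⟨m, σ, Ψ', hΨ', hgen, h'⟩ := ih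
        (ha.map (Φ := fun b j => b (i.succAbove j)) fun j => by fun_prop) (by
          filter_upwards [hc] with x hx
          exact tendsto_pi_nhds.2 fun j => (continuousAt_pi.1 hx) (i.succAbove j))
      refine ⟨m, fun j => i.succAbove (σ j), fun b => Ψ (Ψ' b), fun j => by fun_prop, hgen, ?_⟩
      filter_upwards [h, h'] with x hx hx'
      exact hx.trans (congrArg Ψ hx')

/-- The derivative along a decided tuple of a definable function. -/
theorem Decided.exists_hasDerivAt (hl : IsPlace l) (ha : Decided L l a)
    {q : Fin k → (Fin k → ℝ) → ℝ} (hq : ∀ i, DefFn L (q i))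
    (hd : ∀ᶠ x in l, ∀ i, HasDerivAt (fun x => a x i) (q i (a x)) x)
    {h : (Fin k → ℝ) → ℝ} (hh : DefFn L h) :
    ∃ d, DefFn L d ∧ ∀ᶠ x in l, HasDerivAt (fun x => h (a x)) (d (a x)) x := by
  have hc : ∀ᶠ x in l, ContinuousAt a x :=
    hd.mono fun x hx => continuousAt_pi.2 fun i => (hx i).continuousAt
  -- The tuple may run inside the null set where `h` is not differentiable. Rewriting `h` along it
  -- as `h ∘ Ψ` on a generic subtuple makes the chain rule available.
  obtain ⟨m, σ, Ψ, hΨ, hgen, hΨa⟩ := ha.exists_generic hl hc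
  have hh' : DefFn L fun b => h (Ψ b) := by fun_prop
  refine ⟨fun b => ∑ j, partialDeriv (fun b => h (Ψ b)) j (fun j => b (σ j)) * q (σ j) b, ?_, ?_⟩
  · have := fun j => defFn_partialDeriv hh' j
    fun_prop
  · have hdiff := hgen (fun b => DifferentiableAt ℝ (fun b => h (Ψ b)) b) (by
      have : ∀ b, DifferentiableAt ℝ (fun b => h (Ψ b)) b ↔ _ :=
        fun b => differentiableAt_iff_forall_abs
      simp only [this]
      fun_prop) hh'.ae_differentiableAt
    filter_upwards [hdiff, hd, hl.eventually_eventually_nhds hΨa] with x hx hd hΨx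
    have h1 := hasFDerivAt_sum_partialDeriv hx
    have h2 : HasDerivAt (fun x j => a x (σ j)) (fun j => q (σ j) (a x)) x :=
      hasDerivAt_pi.2 fun j => hd (σ j)
    have h3 := h1.comp_hasDerivAt x h2
    have h4 : (fun x => h (a x)) =ᶠ[𝓝 x] (fun b => h (Ψ b)) ∘ fun x j => a x (σ j) :=
      hΨx.mono fun x' hx' => congrArg h hx'
    refine (h3.congr_of_eventuallyEq h4).congr_deriv ?_
    simp [sum_apply]

/-- A barrier argument: just before the first point `d` after `e` where `w ≤ 0`, the values lie in
the strip `0 < w < E`. There `w` is nondecreasing, so it cannot have come down to `w d`. -/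
theorem pos_of_pos_of_deriv_nonneg {J : Set ℝ} (hJ : J.OrdConnected) {w w' E : ℝ → ℝ}
    (hw : ∀ x ∈ J, HasDerivAt w (w' x) x) (hE : ∀ x ∈ J, ContinuousAt E x)
    (hE0 : ∀ x ∈ J, 0 < E x) (h : ∀ x ∈ J, 0 < w x → w x < E x → 0 ≤ w' x) {e e' : ℝ}
    (he : e ∈ J) (he' : e' ∈ J) (hee : e ≤ e') (hpos : 0 < w e) : 0 < w e' := by
  by_contra hcon
  have hsub : Set.Icc e e' ⊆ J := hJ.out he he'
  have hcont : ContinuousOn w (Set.Icc e e') := fun x hx =>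
    (hw x (hsub hx)).continuousAt.continuousWithinAt
  have hZ : IsCompact (Set.Icc e e' ∩ w ⁻¹' Set.Iic 0) :=
    isCompact_Icc.of_isClosed_subset (hcont.preimage_isClosed_of_isClosed isClosed_Icc isClosed_Iic)
      Set.inter_subset_left
  obtain ⟨d, ⟨hd, hd0⟩, hdmin⟩ := hZ.exists_isLeast ⟨e', ⟨hee, le_rfl⟩, not_lt.1 hcon⟩
  rw [Set.mem_preimage, Set.mem_Iic] at hd0
  have hed : e < d := lt_of_le_of_ne hd.1 fun h => by rw [← h] at hd0; linarith
  have hpos' : ∀ x, e ≤ x → x < d → 0 < w x := by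
    intro x hx hxd
    by_contra hx0
    exact absurd (hdmin ⟨⟨hx, hxd.le.trans hd.2⟩, not_lt.1 hx0⟩) (not_le.2 hxd)
  have hnear : ∀ᶠ x in 𝓝[<] d, w x < E x ∧ e < x := by
    refine mem_nhdsWithin_of_mem_nhds (Filter.inter_mem ?_ (Ioi_mem_nhds hed))
    exact (hw d (hsub hd)).continuousAt.eventually_lt (hE d (hsub hd))
      (hd0.trans_lt (hE0 d (hsub hd)))
  obtain ⟨c, hcd, hc⟩ := mem_nhdsLT_iff_exists_Ioo_subset.1 hnear
  obtain ⟨t, hct, htd⟩ := exists_between (Set.mem_Iio.1 hcd)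
  have het : e < t := (hc ⟨hct, htd⟩).2
  have hJ' : Set.Icc t d ⊆ J := fun x hx => hsub ⟨het.le.trans hx.1, hx.2.trans hd.2⟩
  have hmono : MonotoneOn w (Set.Icc t d) := by
    refine monotoneOn_of_deriv_nonneg (convex_Icc t d)
      (fun x hx => (hw x (hJ' hx)).continuousAt.continuousWithinAt) (fun x hx => ?_) fun x hx => ?_
    · exact (hw x (hJ' (interior_subset hx))).differentiableAt.differentiableWithinAt
    · have hxJ := hJ' (interior_subset hx)
      rw [interior_Icc] at hx
      rw [(hw x hxJ).deriv]
      exact h x hxJ (hpos' x (het.le.trans hx.1.le) hx.2) (hc ⟨hct.trans hx.1, hx.2⟩).1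
  have := hmono ⟨le_rfl, htd.le⟩ ⟨htd.le, le_rfl⟩ htd.le
  linarith [hpos' t het.le htd]

theorem pos_of_pos_of_deriv_nonpos {J : Set ℝ} (hJ : J.OrdConnected) {w w' E : ℝ → ℝ}
    (hw : ∀ x ∈ J, HasDerivAt w (w' x) x) (hE : ∀ x ∈ J, ContinuousAt E x)
    (hE0 : ∀ x ∈ J, 0 < E x) (h : ∀ x ∈ J, 0 < w x → w x < E x → w' x ≤ 0) {e e' : ℝ}
    (he : e ∈ J) (he' : e' ∈ J) (hee : e' ≤ e) (hpos : 0 < w e) : 0 < w e' := by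
  have hJ' : (Neg.neg ⁻¹' J).OrdConnected :=
    ⟨fun x hx y hy z hz => hJ.out hy hx ⟨neg_le_neg hz.2, neg_le_neg hz.1⟩⟩
  have := pos_of_pos_of_deriv_nonneg hJ' (w := fun x => w (-x)) (w' := fun x => -w' (-x))
    (E := fun x => E (-x)) (e := -e) (e' := -e')
    (fun x hx => ((hw (-x) hx).scomp x (hasDerivAt_neg x)).congr_deriv (by simp))
    (fun x hx => ContinuousAt.comp (g := E) (hE (-x) hx) continuous_neg.continuousAt)
    (fun x hx => hE0 (-x) hx) (fun x hx h1 h2 => neg_nonneg.2 (h (-x) hx h1 h2))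
    (by simpa using he) (by simpa using he') (neg_le_neg hee) (by simpa using hpos)
  simpa using this

/-- A definable positive bound below which a definable condition holds. -/
theorem exists_defFn_bound {R : (Fin (k + 1) → ℝ) → Prop} (hR : DefPred L R) :
    ∃ e, DefFn L e ∧ ∀ b, (∀ᶠ s in 𝓝[>] (0 : ℝ), R (Fin.snoc b s)) →
      0 < e b ∧ ∀ s, 0 < s → s < e b → R (Fin.snoc b s) := by
  -- Including `1` keeps the set nonempty, so the infimum does not take the default value `0` when
  -- the condition never fails.
  refine ⟨fun b => sInf {s | (0 < s ∧ ¬ R (Fin.snoc b s)) ∨ s = 1}, DefFn.infimum (by fun_prop),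
    fun b hb => ?_⟩
  set S : Set ℝ := {s | (0 < s ∧ ¬ R (Fin.snoc b s)) ∨ s = 1}
  have hbdd : BddBelow S := ⟨0, by rintro s (⟨h, -⟩ | rfl) <;> linarith⟩
  constructor
  · obtain ⟨c, hc, h⟩ := mem_nhdsGT_iff_exists_Ioo_subset.1 hb
    refine (lt_min (Set.mem_Ioi.1 hc) one_pos).trans_le (le_csInf ⟨1, Or.inr rfl⟩ ?_)
    rintro s (⟨hs, hs'⟩ | rfl)
    · exact (min_le_left _ _).trans (not_lt.1 fun h' => hs' (h ⟨hs, h'⟩))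
    · exact min_le_right _ _
  · intro s hs hse
    by_contra hcon
    exact absurd (csInf_le hbdd (Or.inl ⟨hs, hcon⟩)) (not_le.2 hse)

/-- The difference `u = y - h (a)` solves `u' = Q (a, u)`. O-minimality in `s` and decidedness in
`x` fix whether `Q (a x, s)` is positive for small `s > 0`, and this holds up to a definable
positive height along the tuple. In that strip `u` is monotone, so in one direction of travel it
cannot cease to be positive. The set `u > 0` is then order-connected, hence decided at the place. -/
theorem eventually_lt_or_eventually_not_lt (hl : IsPlace l) (ha : Decided L l a)
    {q : Fin k → (Fin k → ℝ) → ℝ} (hq : ∀ i, DefFn L (q i))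
    (hd : ∀ᶠ x in l, ∀ i, HasDerivAt (fun x => a x i) (q i (a x)) x)
    {y : ℝ → ℝ} {p : (Fin (k + 1) → ℝ) → ℝ} (hp : DefFn L p)
    (hy : ∀ᶠ x in l, HasDerivAt y (p (Fin.snoc (a x) (y x))) x)
    {h : (Fin k → ℝ) → ℝ} (hh : DefFn L h) :
    (∀ᶠ x in l, h (a x) < y x) ∨ (∀ᶠ x in l, ¬ h (a x) < y x) := by
  obtain ⟨d, hdd, hd'⟩ := ha.exists_hasDerivAt hl hq hd hh
  set Q : (Fin (k + 1) → ℝ) → ℝ := fun w =>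
    p (Fin.snoc (Fin.init w) (h (Fin.init w) + w (Fin.last k))) - d (Fin.init w) with hQ
  have hQdef : DefFn L Q := by fun_prop
  have hu : ∀ᶠ x in l, HasDerivAt (fun x => y x - h (a x))
      (Q (Fin.snoc (a x) (y x - h (a x)))) x := by
    filter_upwards [hy, hd'] with x h1 h2
    exact (h1.sub h2).congr_deriv (by simp [hQ])
  have hpl := isPlace_nhdsGT 0
  have hdec : ∀ b : Fin k → ℝ, (∀ᶠ s in 𝓝[>] (0 : ℝ), 0 < Q (Fin.snoc b s)) ∨
      (∀ᶠ s in 𝓝[>] (0 : ℝ), ¬ 0 < Q (Fin.snoc b s)) := fun b =>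
    hpl.eventually_or_eventually_not (L := L) (by fun_prop)
  have hiff : ∀ b : Fin k → ℝ, (∀ᶠ s in 𝓝[>] (0 : ℝ), 0 < Q (Fin.snoc b s)) ↔
      ∃ ε, 0 < ε ∧ ∀ s, 0 < s ∧ s < ε → 0 < Q (Fin.snoc b s) :=
    fun b => mem_nhdsGT_iff_exists_Ioo_subset
  have main : ∀ R : (Fin (k + 1) → ℝ) → Prop, DefPred L R →
      (∀ᶠ x in l, ∀ᶠ s in 𝓝[>] (0 : ℝ), R (Fin.snoc (a x) s)) →
      ∃ (J : Set ℝ) (E : ℝ → ℝ), IsOpenInterval J ∧ J ∈ l ∧ (∀ x ∈ J, ContinuousAt E x) ∧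
        (∀ x ∈ J, 0 < E x) ∧ (∀ x ∈ J, HasDerivAt (fun x => y x - h (a x))
      (Q (Fin.snoc (a x) (y x - h (a x)))) x) ∧
        ∀ x ∈ J, 0 < y x - h (a x) → y x - h (a x) < E x →
          R (Fin.snoc (a x) (y x - h (a x))) := by
    intro R hR hRa
    obtain ⟨e, he, he'⟩ := exists_defFn_bound hR
    obtain ⟨d', -, hd'⟩ := ha.exists_hasDerivAt hl hq hd he
    obtain ⟨J, hJ, hJl, hJ'⟩ := hl.exists_isOpenInterval (hRa.and (hd'.and hu))
    exact ⟨J, fun x => e (a x), hJ, hJl, fun x hx => (hJ' hx).2.1.continuousAt,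
      fun x hx => (he' _ (hJ' hx).1).1, fun x hx => (hJ' hx).2.2,
      fun x hx h1 h2 => (he' _ (hJ' hx).1).2 _ h1 h2⟩
  have hconn : ∃ J ∈ l, ({x | x ∈ J ∧ 0 < y x - h (a x)}).OrdConnected := by
    rcases ha (fun b => ∃ ε, 0 < ε ∧ ∀ s, 0 < s ∧ s < ε → 0 < Q (Fin.snoc b s))
      (by fun_prop) with hcase | hcase
    · obtain ⟨J, E, hJ, hJl, hE, hE0, hw, hR⟩ := main (fun w => 0 < Q w) (by fun_prop)
        (hcase.mono fun x hx => (hiff _).2 hx)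
      refine ⟨J, hJl, ⟨fun x hx z hz t ht => ?_⟩⟩
      have htJ := hJ.2.out hx.1 hz.1 ht
      exact ⟨htJ, pos_of_pos_of_deriv_nonneg hJ.2 hw hE hE0
        (fun x hx h1 h2 => (hR x hx h1 h2).le) hx.1 htJ ht.1 hx.2⟩
    · obtain ⟨J, E, hJ, hJl, hE, hE0, hw, hR⟩ := main (fun w => ¬ 0 < Q w) (by fun_prop)
        (hcase.mono fun x hx => (hdec _).resolve_left fun h => hx ((hiff _).1 h))
      refine ⟨J, hJl, ⟨fun x hx z hz t ht => ?_⟩⟩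
      have htJ := hJ.2.out hx.1 hz.1 ht
      exact ⟨htJ, pos_of_pos_of_deriv_nonpos hJ.2 hw hE hE0
        (fun x hx h1 h2 => not_lt.1 (hR x hx h1 h2)) hz.1 htJ ht.2 hz.2⟩
  obtain ⟨J, hJl, hJ⟩ := hconn
  rcases hl.mem_or_compl_mem_of_ordConnected hJ with h1 | h1
  · exact Or.inl (mem_of_superset h1 fun x hx => sub_pos.1 hx.2)
  · right
    filter_upwards [h1, hJl] with x hx hxJ hlt
    exact hx ⟨hxJ, sub_pos.2 hlt⟩

theorem exists_mem_frontier_of_isPreconnected {s t : Set ℝ} (hs : IsPreconnected s)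
    (h : (s ∩ t).Nonempty) (h' : (s ∩ tᶜ).Nonempty) : ∃ x ∈ s, x ∈ frontier t := by
  by_contra! hcon
  obtain ⟨x, hx, hxt⟩ := h
  obtain ⟨y, hy, hyt⟩ := h'
  obtain ⟨z, -, hz, hz'⟩ := hs (interior t) (closure t)ᶜ isOpen_interior isClosed_closure.isOpen_compl
    (fun z hz => or_iff_not_imp_right.2 fun hc => not_not.1 fun hi => hcon z hz ⟨not_not.1 hc, hi⟩)
    ⟨x, hx, not_not.1 fun hi => hcon x hx ⟨subset_closure hxt, hi⟩⟩
    ⟨y, hy, fun hc => hcon y hy ⟨hc, fun hi => hyt (interior_subset hi)⟩⟩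
  exact hz' (subset_closure (interior_subset hz))

theorem defPred_mem_frontier {D : (Fin (k + 1) → ℝ) → Prop} (hD : DefPred L D) :
    DefPred L fun w : Fin (k + 1) → ℝ => w (Fin.last k) ∈ frontier (fiber D (Fin.init w)) := by
  have key : DefPred L fun w : Fin (k + 1) → ℝ =>
      (∀ ε, 0 < ε → ∃ z, D (Fin.snoc (Fin.init w) z) ∧ |w (Fin.last k) - z| < ε) ∧
      (∀ ε, 0 < ε → ∃ z, ¬ D (Fin.snoc (Fin.init w) z) ∧ |w (Fin.last k) - z| < ε) := by
    fun_prop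
  refine key.congr fun w => ?_
  rw [frontier_eq_closure_inter_closure, Set.mem_inter_iff, Metric.mem_closure_iff,
    Metric.mem_closure_iff]
  rfl

/-- Were an interval contained in the frontier, o-minimality to the right of one of its points would
yield points interior to the fibre or to its complement. -/
theorem finite_frontier_fiber {D : (Fin (k + 1) → ℝ) → Prop} (hD : DefPred L D) (b : Fin k → ℝ) :
    (frontier (fiber D b)).Finite := by
  have hdef := defPred_mem_frontier hD
  set B := fun w : Fin (k + 1) → ℝ => w (Fin.last k) ∈ frontier (fiber D (Fin.init w)) with hB
  have hfr : frontier (fiber D b) = {y | B (Fin.snoc b y)} := by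
    ext y; simp [hB]
  rw [hfr]
  refine (finite_or_exists_Ioo_subset (L := L) (s := fun y => B (Fin.snoc b y))
    (by fun_prop)).resolve_right ?_
  rintro ⟨p, q, hpq, h⟩
  have h' : ∀ x ∈ Set.Ioo p q, x ∈ frontier (fiber D b) := fun x hx => by
    rw [hfr]; exact h x hx
  obtain ⟨t, ht⟩ := exists_between hpq
  have hIoo : ∀ᶠ s in 𝓝[>] t, s ∈ Set.Ioo p q :=
    mem_nhdsWithin_of_mem_nhds (Ioo_mem_nhds ht.1 ht.2)
  have hdec := (isPlace_nhdsGT t).eventually_or_eventually_not (L := L)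
    (s := fun y => D (Fin.snoc b y)) (by fun_prop)
  rcases hdec with hdec | hdec
  · obtain ⟨s, hs, hs'⟩ :=
      (((isPlace_nhdsGT t).eventually_eventually_nhds hdec).and hIoo).exists
    exact (h' s hs').2 (mem_interior_iff_mem_nhds.2 hs)
  · obtain ⟨s, hs, hs'⟩ :=
      (((isPlace_nhdsGT t).eventually_eventually_nhds hdec).and hIoo).exists
    have := h' s hs'
    rw [← frontier_compl] at this
    exact this.2 (mem_interior_iff_mem_nhds.2 hs)

/-- Solutions of definable differential equations over decided tuples are decided. -/
theorem Decided.snoc (hl : IsPlace l) (ha : Decided L l a)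
    {q : Fin k → (Fin k → ℝ) → ℝ} (hq : ∀ i, DefFn L (q i))
    (hd : ∀ᶠ x in l, ∀ i, HasDerivAt (fun x => a x i) (q i (a x)) x)
    {y : ℝ → ℝ} {p : (Fin (k + 1) → ℝ) → ℝ} (hp : DefFn L p)
    (hy : ∀ᶠ x in l, HasDerivAt y (p (Fin.snoc (a x) (y x))) x) :
    Decided L l fun x => (Fin.snoc (a x) (y x) : Fin (k + 1) → ℝ) := by
  intro D hD
  have hlt : ∀ h, DefFn L h → (∀ᶠ x in l, h (a x) < y x) ∨ (∀ᶠ x in l, ¬ h (a x) < y x) :=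
    fun h hh => eventually_lt_or_eventually_not_lt hl ha hq hd hp hy hh
  have hgt : ∀ h, DefFn L h → (∀ᶠ x in l, y x < h (a x)) ∨ (∀ᶠ x in l, ¬ y x < h (a x)) := by
    intro h hh
    have := eventually_lt_or_eventually_not_lt hl ha hq hd (y := fun x => -y x)
      (p := fun w => -p (Fin.snoc (Fin.init w) (-w (Fin.last k)))) (by fun_prop)
      (hy.mono fun x hx => hx.neg.congr_deriv (by simp)) (h := fun b => -h b) (by fun_prop)
    simpa only [neg_lt_neg_iff] using this
  have hc : ∀ᶠ x in l, ContinuousAt a x :=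
    hd.mono fun x hx => continuousAt_pi.2 fun i => (hx i).continuousAt
  have hB := defPred_mem_frontier hD
  set B := fun w : Fin (k + 1) → ℝ => w (Fin.last k) ∈ frontier (fiber D (Fin.init w)) with hBdef
  have hfr : ∀ b, fiber B b = frontier (fiber D b) := by
    intro b; ext y; simp [hBdef, fiber]
  have hfin : ∀ b, (fiber B b).Finite := fun b => by
    rw [hfr]; exact finite_frontier_fiber hD b
  obtain ⟨N, hN⟩ := (dependent_and_exists_eventually_ncard_eq hl k).2 a ha hc B hB hfin
  have hξ := fun j => defFn_nthFiber hB j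
  -- Either `y` is eventually a frontier point of given rank, hence a definable function of the
  -- tuple, or it lies strictly on a fixed side of each of the `N` frontier points.
  by_cases heq : ∃ j, ∀ᶠ x in l, y x = nthFiber B j (a x)
  · obtain ⟨j, hj⟩ := heq
    have := hξ j
    refine (ha (fun b => D (Fin.snoc b (nthFiber B j b))) (by fun_prop)).imp (fun h => ?_)
      fun h => ?_
    · filter_upwards [h, hj] with x h hj
      rwa [hj]
    · filter_upwards [h, hj] with x h hj
      rwa [hj]
  · have hside : ∀ j, (∀ᶠ x in l, nthFiber B j (a x) < y x) ∨
        (∀ᶠ x in l, y x < nthFiber B j (a x)) := by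
      intro j
      rcases hlt _ (hξ j) with h | h
      · exact Or.inl h
      · rcases hgt _ (hξ j) with h' | h'
        · exact Or.inr h'
        · refine absurd ⟨j, ?_⟩ heq
          filter_upwards [h, h'] with x h h'
          exact le_antisymm (not_lt.1 h) (not_lt.1 h')
    set s : Fin N → Prop := fun j => ∀ᶠ x in l, nthFiber B j (a x) < y x with hs
    have hyside : ∀ᶠ x in l, ∀ j : Fin N, (s j → nthFiber B j (a x) < y x) ∧
        (¬ s j → y x < nthFiber B j (a x)) := by
      rw [Filter.eventually_all]
      intro j
      by_cases hsj : s j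
      · filter_upwards [hsj] with x hx
        exact ⟨fun _ => hx, fun h => absurd hsj h⟩
      · filter_upwards [(hside j).resolve_left hsj] with x hx
        exact ⟨fun h => absurd h hsj, fun _ => hx⟩
    -- The segment between two points on the same sides of all frontier points misses the frontier.
    -- Whether `y x` is in the fibre can thus be read off any such `z`, which is a condition on `a
    -- x` alone.
    have hiff : ∀ᶠ x in l, D (Fin.snoc (a x) (y x)) ↔
        ∃ z, (∀ j : Fin N, (s j → nthFiber B j (a x) < z) ∧
          (¬ s j → z < nthFiber B j (a x))) ∧ D (Fin.snoc (a x) z) := by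
      filter_upwards [hyside, hN] with x hx hxN
      refine ⟨fun h => ⟨y x, hx, h⟩, fun ⟨z, hz, hDz⟩ => ?_⟩
      by_contra hcon
      obtain ⟨t, ht, htf⟩ := exists_mem_frontier_of_isPreconnected
        (isPreconnected_uIcc (a := z) (b := y x)) (t := fiber D (a x)) ⟨z, Set.left_mem_uIcc, hDz⟩ ⟨y x, Set.right_mem_uIcc, hcon⟩
      rw [← hfr, mem_fiber_iff (hfin _)] at htf
      obtain ⟨j, hj, rfl⟩ := htf
      rw [hxN] at hj
      by_cases hsj : s ⟨j, hj⟩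
      · have h1 := (hx ⟨j, hj⟩).1 hsj
        have h2 := (hz ⟨j, hj⟩).1 hsj
        exact absurd (lt_min h2 h1) (not_lt.2 ht.1)
      · have h1 := (hx ⟨j, hj⟩).2 hsj
        have h2 := (hz ⟨j, hj⟩).2 hsj
        exact absurd (max_lt h2 h1) (not_lt.2 ht.2)
    refine (ha (fun b => ∃ z, (∀ j : Fin N, (s j → nthFiber B j b < z) ∧
          (¬ s j → z < nthFiber B j b)) ∧ D (Fin.snoc b z)) (by fun_prop)).imp (fun h => ?_)
      fun h => ?_
    · filter_upwards [h, hiff] with x h hj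
      exact hj.2 h
    · filter_upwards [h, hiff] with x h hj
      exact fun h' => h (hj.1 h')

end Hardy

/-! ### Pfaffian chains -/

section Chains

variable {L : FirstOrder.Language.{u, v}} [L.Structure ℝ] {n : ℕ} {I : Set ℝ} {l : Filter ℝ}

/-- The tuple `(x, f 0 x, …, f (n - 1) x)`. -/
def chainTuple (f : Fin n → ℝ → ℝ) (x : ℝ) : Fin (n + 1) → ℝ := Fin.cons x fun j => f j x

theorem IsPfaffianChainOn.mono {f : Fin n → ℝ → ℝ} (hf : IsPfaffianChainOn L I f) {J : Set ℝ}
    (hJ : J ⊆ I) : IsPfaffianChainOn L J f := by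
  obtain ⟨han, p, hp, h⟩ := hf
  exact ⟨fun i => (han i).mono hJ, p, hp, fun i x hx => h i x (hJ hx)⟩

theorem IsPfaffianChainOn.castSucc {f : Fin (n + 1) → ℝ → ℝ} (hf : IsPfaffianChainOn L I f) :
    IsPfaffianChainOn L I fun i : Fin n => f i.castSucc := by
  obtain ⟨han, p, hp, h⟩ := hf
  exact ⟨fun i => han _, fun i => p i.castSucc, fun i => hp _, fun i x hx => h i.castSucc x hx⟩

theorem IsPfaffianChainOn.exists_hasDerivAt {f : Fin n → ℝ → ℝ} (hf : IsPfaffianChainOn L I f) :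
    ∃ q : Fin (n + 1) → (Fin (n + 1) → ℝ) → ℝ, (∀ i, DefFn L (q i)) ∧
      ∀ x ∈ I, ∀ i, HasDerivAt (fun x => chainTuple f x i) (q i (chainTuple f x)) x := by
  obtain ⟨han, p, hp, h⟩ := hf
  refine ⟨Fin.cons (fun _ => 1) fun i w => p i fun j => w (j.castLE (by omega)), fun i => ?_,
    fun x hx i => ?_⟩
  · cases i using Fin.cases with
    | zero => exact DefFn.const 1
    | succ i =>
      have : DefFn L (p i) := hp i
      simp only [Fin.cons_succ]
      fun_prop
  · cases i using Fin.cases with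
    | zero => exact hasDerivAt_id x
    | succ i =>
      simp only [chainTuple, Fin.cons_succ]
      convert h i x hx using 2
      ext j
      cases j using Fin.cases with
      | zero => rfl
      | succ j => rfl

theorem chainTuple_succ (f : Fin (n + 1) → ℝ → ℝ) (x : ℝ) : chainTuple f x =
    Fin.snoc (chainTuple (fun i : Fin n => f i.castSucc) x) (f (Fin.last n) x) := by
  rw [chainTuple, chainTuple, ← Fin.cons_snoc_eq_snoc_cons]
  congr 1
  exact (Fin.snoc_init_self fun j => f j x).symm

/-- Keeping `x` as a coordinate makes the system autonomous, and the base case becomes o-minimality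
at the place. -/
theorem IsPfaffianChainOn.decided [hO : Fact (IsOMinimalExpansion L)] {f : Fin n → ℝ → ℝ}
    (hf : IsPfaffianChainOn L I f) (hl : IsPlace l) (hIl : I ∈ l) :
    Decided L l (chainTuple f) := by
  induction n with
  | zero =>
    intro D hD
    have : ∀ x, chainTuple f x = fun _ => x := fun x => funext fun i => by
      cases i using Fin.cases with
      | zero => rfl
      | succ i => exact i.elim0
    simp only [this]
    exact hl.eventually_or_eventually_not (L := L) (by fun_prop)
  | succ n ih =>
    obtain ⟨q, hq, hd⟩ := hf.castSucc.exists_hasDerivAt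
    have hrec := ih hf.castSucc
    obtain ⟨han, p, hp, h⟩ := hf
    have := hrec.snoc hl hq (by filter_upwards [hIl] with x hx using hd x hx)
      (y := f (Fin.last n)) (p := p (Fin.last n)) (hp (Fin.last n)) (by
        filter_upwards [hIl] with x hx
        rw [← chainTuple_succ]
        exact h (Fin.last n) x hx)
    simpa only [← chainTuple_succ] using this

theorem IsPfaffianChainOn.decided_tail [hO : Fact (IsOMinimalExpansion L)] {f : Fin n → ℝ → ℝ}
    (hf : IsPfaffianChainOn L I f) (hl : IsPlace l) (hIl : I ∈ l) :
    Decided L l fun x j => f j x :=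
  (hf.decided hl hIl).map (Φ := fun b j => b j.succ) fun j => by fun_prop

theorem IsPfaffianChainOn.eventually_continuousAt {f : Fin n → ℝ → ℝ}
    (hf : IsPfaffianChainOn L I f) (hIl : I ∈ l) :
    ∀ᶠ x in l, ContinuousAt (fun x j => f j x) x := by
  filter_upwards [hIl] with x hx
  exact continuousAt_pi.2 fun j => (hf.1 j x hx).continuousAt

/-- Removing from a chain a function that is definable from `x` and the preceding functions. -/
theorem IsPfaffianChainOn.comp_succAbove {f : Fin (n + 1) → ℝ → ℝ} (hf : IsPfaffianChainOn L I f)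
    (i : Fin (n + 1)) {F : (Fin (i.val + 1) → ℝ) → ℝ} (hF : DefFn L F)
    (h : ∀ x ∈ I, f i x = F (Fin.cons x fun j : Fin i.val => f (j.castLE i.isLt.le) x)) :
    IsPfaffianChainOn L I fun j : Fin n => f (i.succAbove j) := by
  obtain ⟨han, p, hp, hd⟩ := hf
  let e : ∀ {k : ℕ}, (Fin k → ℝ) → ℕ → ℝ := fun {k} w t => if ht : t < k then w ⟨t, ht⟩ else 0
  have he : ∀ (k t : ℕ), DefFn L fun w : Fin k → ℝ => e w t := by
    intro k t
    by_cases ht : t < k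
    · simpa only [e, ht, dite_true] using DefFn.proj _
    · simpa only [e, ht, dite_false] using DefFn.const _
  -- Position `0` holds `x`, so `f i` occupied position `i + 1`. Earlier arguments are unchanged,
  -- that position is refilled by `F` of positions `0, …, i`, and later arguments shift by one.
  refine ⟨fun j => han _, fun j w => p (i.succAbove j) fun m =>
    if m.val ≤ i.val then e w m.val else if m.val = i.val + 1 then F fun t => e w t.val
      else e w (m.val - 1), fun j => ?_, fun j x hx => ?_⟩
  · have : DefFn L (p (i.succAbove j)) := hp _
    refine this.comp fun m => ?_
    split_ifs
    · exact he _ _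
    · exact hF.comp fun t => he _ _
    · exact he _ _
  · convert hd (i.succAbove j) x hx using 2
    ext m
    have hval : (i.succAbove j).val = if j.val < i.val then j.val else j.val + 1 := by
      split_ifs with hji
      · rw [Fin.succAbove_of_castSucc_lt _ _ hji]; rfl
      · rw [Fin.succAbove_of_le_castSucc _ _ (not_lt.1 hji)]; rfl
    have hm := m.isLt
    have hex : ∀ (t : ℕ) (ht : t < j.val + 1), e (Fin.cons x fun r : Fin (j.val + 1) =>
        f (i.succAbove (r.castLE j.isLt)) x : Fin (j.val + 2) → ℝ) (t + 1) =
          f (i.succAbove ⟨t, by omega⟩) x := by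
      intro t ht
      simp only [e, Nat.add_lt_add_iff_right, ht, dite_true]
      exact Fin.cons_succ (α := fun _ => ℝ) x _ ⟨t, ht⟩
    cases m using Fin.cases with
    | zero => simp [e]
    | succ m =>
      simp only [Fin.val_succ, Fin.cons_succ] at hm ⊢
      rcases lt_trichotomy m.val i.val with hmi | hmi | hmi
      · rw [if_pos (by omega), hex _ (by split_ifs at hval <;> omega),
          Fin.succAbove_of_castSucc_lt _ _ hmi]
        rfl
      · rw [if_neg (by omega), if_pos (by omega)]
        have hmi' : m.castLE (i.succAbove j).isLt = i := Fin.ext hmi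
        rw [hmi', h x hx]
        congr 1
        ext t
        cases t using Fin.cases with
        | zero => simp [e]
        | succ t =>
          have := t.isLt
          rw [Fin.val_succ, hex _ (by split_ifs at hval <;> omega),
            Fin.succAbove_of_castSucc_lt _ _ t.isLt]
          rfl
      · obtain ⟨t, ht⟩ : ∃ t, m.val = t + 1 := ⟨m.val - 1, by omega⟩
        rw [if_neg (by omega), if_neg (by omega), ht, Nat.add_sub_cancel,
          hex _ (by split_ifs at hval <;> omega), Fin.succAbove_of_le_castSucc]
        · congr 1
          exact Fin.ext ht.symm
        · change i.val ≤ t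
          omega

theorem mem_ext_iff {f : Fin n → ℝ → ℝ} {a : Germ l ℝ} : a ∈ ext L l f ↔
    ∃ F : (Fin n → ℝ) → ℝ, DefFn L F ∧ a = ((fun x => F fun j => f j x : ℝ → ℝ) : Germ l ℝ) := by
  constructor
  · rintro ⟨k, F, h, hF, hh, rfl⟩
    choose τ hτ using hh
    have hF' : DefFn L F := hF
    refine ⟨fun v => F fun t => v (τ t), by fun_prop, Germ.coe_eq.2 ?_⟩
    have : ∀ t, ∀ᶠ x in l, f (τ t) x = h t x := fun t => Germ.coe_eq.1 (hτ t)
    filter_upwards [eventually_all.2 this] with x hx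
    simp only [hx]
  · rintro ⟨F, hF, rfl⟩
    exact ⟨n, F, f, hF, fun i => ⟨i, rfl⟩, rfl⟩

theorem ext_comp_succAbove {f : Fin (n + 1) → ℝ → ℝ} (i : Fin (n + 1))
    {F : (Fin i.val → ℝ) → ℝ} (hF : DefFn L F)
    (h : ∀ᶠ x in l, f i x = F fun j => f (j.castLE i.isLt.le) x) :
    ext L l (fun j : Fin n => f (i.succAbove j)) = ext L l f := by
  obtain ⟨Ψ, hΨ, hΨf⟩ := exists_eq_comp_succAbove (l := l) (a := fun x j => f j x) i hF h
  ext b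
  rw [mem_ext_iff, mem_ext_iff]
  constructor
  · rintro ⟨G, hG, rfl⟩
    exact ⟨fun v => G fun j => v (i.succAbove j), by fun_prop, rfl⟩
  · rintro ⟨G, hG, rfl⟩
    refine ⟨fun c => G (Ψ c), by fun_prop, Germ.coe_eq.2 ?_⟩
    filter_upwards [hΨf] with x hx
    exact congrArg G hx

open MeasureTheory

variable [hO : Fact (IsOMinimalExpansion L)]

/-- Otherwise some member is, on a smaller interval at the place, a definable function of the
preceding ones, and dropping it gives a shorter chain. The tuple omits `x`, which need not belong to
the extension. -/
theorem IsMinimalChainAt.generic (hl : IsPlace l) {g : Fin n → ℝ → ℝ}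
    (hg : IsMinimalChainAt L l g) : Generic L l fun x j => g j x := by
  obtain ⟨⟨J, hJ, hJl, hgJ⟩, hmin⟩ := hg
  refine ((hgJ.decided_tail hl hJl).generic_or_dependent hl
    (hgJ.eventually_continuousAt hJl)).resolve_right ?_
  rintro ⟨i, F, hF, h⟩
  cases n with
  | zero => exact i.elim0
  | succ n =>
    obtain ⟨J', hJ', hJl', hJJ'⟩ := hl.exists_isOpenInterval (inter_mem hJl h)
    have hchain := (hgJ.mono fun x hx => (hJJ' hx).1).comp_succAbove (I := J') i
      (F := fun w => F fun j => w j.succ) (by fun_prop) fun x hx => (hJJ' hx).2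
    have := hmin n _ ⟨J', hJ', hJl', hchain⟩ (ext_comp_succAbove i hF h)
    omega

/-- Moving the `i`-th coordinate alone destroys the equation, so the graph has no interior. -/
theorem ae_ne_apply_of_notMem {m : ℕ} {F : (Fin m → ℝ) → ℝ} (hF : DefFn L F) (i : Fin n)
    {τ : Fin m → Fin n} (hτ : ∀ t, τ t ≠ i) : ∀ᵐ v : Fin n → ℝ, v i ≠ F fun t => v (τ t) := by
  refine DefPred.ae_not_of_interior_eq_empty (L := L) (by fun_prop) fun b hb => ?_
  have hcont : Tendsto (fun s : ℝ => Function.update b i s) (𝓝 (b i)) (𝓝 b) := by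
    have : Continuous fun s : ℝ => Function.update b i s := continuous_const.update i continuous_id
    simpa using this.tendsto (b i)
  have h1 := (hcont.eventually hb).filter_mono (nhdsWithin_le_nhds (s := {b i}ᶜ))
  obtain ⟨s, hs, hsb⟩ := (h1.and self_mem_nhdsWithin).exists
  have h2 := hb.self_of_nhds
  simp only [Function.update_self, Function.update_of_ne (hτ _)] at hs
  exact hsb (hs.trans h2.symm)

theorem Generic.not_eventually_eq {a : ℝ → Fin n → ℝ} (hl : IsPlace l) (ha : Generic L l a)
    {m : ℕ} {F : (Fin m → ℝ) → ℝ} (hF : DefFn L F) (i : Fin n) {τ : Fin m → Fin n}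
    (hτ : ∀ t, τ t ≠ i) : ¬ ∀ᶠ x in l, a x i = F fun t => a x (τ t) := by
  intro h
  have := hl.neBot
  obtain ⟨x, hx, hx'⟩ := ((ha _ (DefPred.not (by fun_prop)) (ae_ne_apply_of_notMem hF i hτ)).and
    h).exists
  exact hx hx'

theorem Generic.germ_injective {g : Fin n → ℝ → ℝ} (hl : IsPlace l)
    (hg : Generic L l fun x j => g j x) : Function.Injective fun i => (g i : Germ l ℝ) := by
  intro i j hij
  by_contra hne
  refine hg.not_eventually_eq hl (F := fun v : Fin 1 → ℝ => v 0) (DefFn.proj 0) i (τ := fun _ => j)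
    (fun _ => Ne.symm hne) ?_
  exact Germ.coe_eq.1 hij

theorem Generic.dclIndep {g : Fin n → ℝ → ℝ} (hl : IsPlace l)
    (hg : Generic L l fun x j => g j x) : DclIndep L l (Set.range fun i => (g i : Germ l ℝ)) := by
  rintro _ ⟨i, rfl⟩ ⟨k, F, h, hF, hh, heq⟩
  choose τ hτ using fun t => (hh t).1
  refine hg.not_eventually_eq hl hF i (τ := τ) (fun t ht => (hh t).2 ?_) ?_
  · rw [Set.mem_singleton_iff, ← hτ t, ht]
  · have : ∀ t, ∀ᶠ x in l, g (τ t) x = h t x := fun t => Germ.coe_eq.1 (hτ t)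
    filter_upwards [eventually_all.2 this, Germ.coe_eq.1 heq] with x hx hx'
    simp only [hx]
    exact hx'

/-- The image of `ℝ ^ m` in `ℝ ^ (m + 1)` under a definable map is null, off the points where the
map is not differentiable. -/
theorem ae_not_mem_image_differentiableAt {m : ℕ} {F : Fin (m + 1) → (Fin m → ℝ) → ℝ} :
    ∀ᵐ w : Fin (m + 1) → ℝ, ¬ ∃ b, (∀ j, DifferentiableAt ℝ (F j) b) ∧ ∀ j, w j = F j b := by
  -- The map is extended to `ℝ ^ (m + 1)` by ignoring the last coordinate. The image comes from a
  -- hyperplane, and differentiable maps between spaces of equal dimension preserve null sets.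
  set s : Set (Fin (m + 1) → ℝ) := {w | w (Fin.last m) = 0 ∧
    ∀ j, DifferentiableAt ℝ (F j) (Fin.init w)}
  set f : (Fin (m + 1) → ℝ) → Fin (m + 1) → ℝ := fun w j => F j (Fin.init w)
  have hf : DifferentiableOn ℝ f s := by
    intro w hw
    refine DifferentiableAt.differentiableWithinAt (differentiableAt_pi.2 fun j => ?_)
    have hinit : DifferentiableAt ℝ (fun w : Fin (m + 1) → ℝ => (Fin.init w : Fin m → ℝ)) w :=
      differentiableAt_pi.2 fun i => differentiableAt_apply _ _
    exact DifferentiableAt.comp (g := F j) w (hw.2 j) hinit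
  have hs : volume s = 0 :=
    measure_mono_null (fun w hw => hw.1) (Measure.pi_hyperplane (fun _ => volume) (Fin.last m) 0)
  refine measure_mono_null ?_ (addHaar_image_eq_zero_of_differentiableOn_of_addHaar_eq_zero _ hf hs)
  intro w hw
  obtain ⟨b, hb, hw⟩ := not_not.1 hw
  refine ⟨Fin.snoc b 0, ⟨by simp, by simpa using hb⟩, funext fun j => ?_⟩
  simp [f, hw]

/-- Among `n + 1` germs of the extension one is definable from its predecessors: together they form
a decided tuple in the image of points of differentiability of a definable map from `ℝ ^ n`, which
is null. -/
theorem Generic.encard_le_of_dclIndep {g : Fin n → ℝ → ℝ} (hl : IsPlace l)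
    (hg : Generic L l fun x j => g j x) (hd : Decided L l fun x j => g j x)
    (hc : ∀ᶠ x in l, ContinuousAt (fun x j => g j x) x) {B : Set (Germ l ℝ)}
    (hB : B ⊆ ext L l g) (hind : DclIndep L l B) : B.encard ≤ n := by
  by_contra hcon
  obtain ⟨t, htB, ht⟩ := Set.exists_subset_encard_eq (Order.add_one_le_of_lt (not_le.1 hcon))
  have htfin : t.Finite := Set.finite_of_encard_eq_coe (k := n + 1) (by simpa using ht)
  have : Finite t := htfin
  have htcard : Nat.card t = n + 1 := by
    have := htfin.cast_ncard_eq
    rw [ht] at this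
    rw [Nat.card_coe_set_eq]
    exact_mod_cast this
  let e := (Finite.equivFinOfCardEq htcard).symm
  choose F hF hFe using fun j => mem_ext_iff.1 (hB (htB (e j).2))
  have hdiff : ∀ᶠ x in l, ∀ j, DifferentiableAt ℝ (F j) fun i => g i x := by
    rw [eventually_all]
    intro j
    have := hF j
    refine hg (fun b => DifferentiableAt ℝ (F j) b) ?_ (hF j).ae_differentiableAt
    simp only [differentiableAt_iff_forall_abs]
    fun_prop
  have hdep : Dependent L l fun x j => F j fun i => g i x := by
    refine (dependent_and_exists_eventually_ncard_eq hl (n + 1)).1 _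
      (hd.map (Φ := fun b j => F j b) hF) ?_ _ ?_ (ae_not_mem_image_differentiableAt (F := F)) ?_
    · filter_upwards [hc, hdiff] with x hx hx'
      exact continuousAt_pi.2 fun j => ContinuousAt.comp (g := F j) (hx' j).continuousAt hx
    · simp only [differentiableAt_iff_forall_abs]
      fun_prop
    · filter_upwards [hdiff] with x hx
      exact ⟨_, hx, fun j => rfl⟩
  obtain ⟨i, G, hG, h⟩ := hdep
  refine hind (e i) (htB (e i).2) ⟨i, G, fun j x => F (j.castLE i.isLt.le) fun i => g i x, hG,
    fun j => ?_, ?_⟩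
  · rw [← hFe]
    refine ⟨htB (e _).2, fun h => ?_⟩
    have := congrArg Fin.val (e.injective (Subtype.ext h))
    simp only [Fin.val_castLE] at this
    exact absurd this j.isLt.ne
  · rw [hFe i]
    exact Germ.coe_eq.2 h

theorem IsMinimalChainAt.dclTrdeg_ext (hl : IsPlace l) {g : Fin n → ℝ → ℝ}
    (hg : IsMinimalChainAt L l g) : dclTrdeg L l (ext L l g) = n := by
  have hgen := hg.generic hl
  obtain ⟨⟨J, hJ, hJl, hgJ⟩, -⟩ := hg
  refine le_antisymm (iSup_le fun B => ?_) ?_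
  · exact hgen.encard_le_of_dclIndep hl (hgJ.decided_tail hl hJl) (hgJ.eventually_continuousAt hJl)
      B.2.1 B.2.2
  · have hsub : (Set.range fun i => (g i : Germ l ℝ)) ⊆ ext L l g := by
      rintro _ ⟨i, rfl⟩
      exact mem_ext_iff.2 ⟨fun v => v i, DefFn.proj i, rfl⟩
    refine le_trans (le_of_eq ?_) (le_iSup (fun B : {B : Set (Germ l ℝ) //
      B ⊆ ext L l g ∧ DclIndep L l B} => B.1.encard) ⟨_, hsub, hgen.dclIndep hl⟩)
    change _ = (Set.range _).encard
    rw [← Set.image_univ, (hgen.germ_injective hl).encard_image, Set.encard_univ]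
    simp

end Chains

/-! ### Algebraic relations on the whole interval -/

theorem exists_defFn_of_forall_exists {L : FirstOrder.Language.{u, v}} [L.Structure ℝ]
    {m : ℕ} {E : ℕ → ℝ → Prop}
    (hE : ∀ j, DefPred L fun x : Fin 1 → ℝ => E j (x 0)) {G : ℕ → (Fin m → ℝ) → ℝ}
    (hG : ∀ j, DefFn L (G j)) {y : ℝ → ℝ} {b : ℝ → Fin m → ℝ} (h : ∀ j x, E j x → y x = G j (b x))
    (N : ℕ) : ∃ F : (Fin (m + 1) → ℝ) → ℝ, DefFn L F ∧
      ∀ x, (∃ j < N, E j x) → y x = F (Fin.cons x (b x)) := by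
  classical
  induction N with
  | zero => exact ⟨fun _ => 0, DefFn.const 0, fun x ⟨j, hj, _⟩ => absurd hj (Nat.not_lt_zero j)⟩
  | succ N ih =>
    obtain ⟨F, hF, hF'⟩ := ih
    refine ⟨fun w => if E N (w 0) then G N (fun j => w j.succ) else F w, ?_, fun x hx => ?_⟩
    · have h1 := hE N
      have h2 := hG N
      have h3 : DefPred L fun w : Fin (m + 1) → ℝ => E N (w 0) :=
        h1.comp (g := fun w _ => w 0) fun _ => DefFn.proj 0
      convert DefFn.ite h3 (f := fun w => G N fun j => w j.succ) (by fun_prop) hF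
    · by_cases hxN : E N x
      · simpa [hxN] using h N x hxN
      · obtain ⟨j, hj, hjx⟩ := hx
        have hjN : j ≠ N := fun h => hxN (h ▸ hjx)
        simpa [hxN] using hF' x ⟨j, by omega, hjx⟩

section Global

variable {L : FirstOrder.Language.{u, v}} [L.Structure ℝ] {n : ℕ} {I : Set ℝ} {l : Filter ℝ}
  [hO : Fact (IsOMinimalExpansion L)]

/-- A subset of the line that is decided at every place is definable. -/
theorem defPred_of_forall_isPlace {E : ℝ → Prop}
    (hE : ∀ l, IsPlace l → (∀ᶠ x in l, E x) ∨ (∀ᶠ x in l, ¬ E x)) :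
    DefPred L fun x : Fin 1 → ℝ => E (x 0) := by
  -- `Q s` says that `s` has a definable superset meeting `E` in a definable set. It passes to
  -- subsets and finite unions, so compactness reduces the claim to one-sided neighbourhoods, single
  -- points and the two ends.
  let Q : Set ℝ → Prop := fun s => ∃ t : ℝ → Prop, (∀ x ∈ s, t x) ∧
    DefPred L (fun x : Fin 1 → ℝ => t (x 0)) ∧ DefPred L (fun x : Fin 1 → ℝ => E (x 0) ∧ t (x 0))
  have hconst : ∀ t : Set ℝ, DefPred L (fun x : Fin 1 → ℝ => x 0 ∈ t) →
      (t ⊆ {x | E x} ∨ t ⊆ {x | ¬ E x}) → Q t := by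
    intro t ht h
    refine ⟨fun x => x ∈ t, fun x hx => hx, ht, ?_⟩
    rcases h with h | h
    · exact ht.congr fun x => ⟨fun hx => hx.2, fun hx => ⟨h hx, hx⟩⟩
    · exact (DefPred.const False).congr fun x => ⟨fun hx => h hx.2 hx.1, False.elim⟩
  have hunion : ∀ s t, Q s → Q t → Q (s ∪ t) := by
    rintro s t ⟨s', hs, hs1, hs2⟩ ⟨t', ht, ht1, ht2⟩
    refine ⟨fun x => s' x ∨ t' x, fun x hx => hx.imp (hs x) (ht x), hs1.or ht1, ?_⟩
    exact (hs2.or ht2).congr fun x => and_or_left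
  have hmono : ∀ s t, s ⊆ t → Q t → Q s := fun s t hst ⟨t', ht, h⟩ =>
    ⟨t', fun x hx => ht x (hst hx), h⟩
  obtain ⟨M, hM⟩ : ∃ M, Q (Set.Ioi M) := by
    rcases hE atTop (Or.inl rfl) with h | h <;> obtain ⟨M, hM⟩ := (eventually_gt_atTop 0).and h
      |>.exists_forall_of_atTop
    · exact ⟨M, hconst _ (by simp only [Set.mem_Ioi]; fun_prop)
        (Or.inl fun x hx => (hM x (le_of_lt hx)).2)⟩
    · exact ⟨M, hconst _ (by simp only [Set.mem_Ioi]; fun_prop)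
        (Or.inr fun x hx => (hM x (le_of_lt hx)).2)⟩
  obtain ⟨M', hM'⟩ : ∃ M, Q (Set.Iio M) := by
    rcases hE atBot (Or.inr (Or.inl rfl)) with h | h <;> obtain ⟨M, hM⟩ := eventually_atBot.1 h
    · exact ⟨M, hconst _ (by simp only [Set.mem_Iio]; fun_prop)
        (Or.inl fun x hx => hM x (le_of_lt hx))⟩
    · exact ⟨M, hconst _ (by simp only [Set.mem_Iio]; fun_prop)
        (Or.inr fun x hx => hM x (le_of_lt hx))⟩
  have hIcc : Q (Set.Icc M' M) := by
    refine isCompact_Icc.induction_on (p := Q) ?_ hmono hunion fun p _ => ?_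
    · exact hconst ∅ (DefPred.const False) (Or.inl (Set.empty_subset _))
    · obtain ⟨q, hq, h1⟩ : ∃ q, p < q ∧ Q (Set.Ioo p q) := by
        rcases hE _ (isPlace_nhdsGT p) with h | h <;>
          obtain ⟨q, hq, h⟩ := mem_nhdsGT_iff_exists_Ioo_subset.1 h
        · exact ⟨q, hq, hconst _ (by simp only [Set.mem_Ioo]; fun_prop) (Or.inl h)⟩
        · exact ⟨q, hq, hconst _ (by simp only [Set.mem_Ioo]; fun_prop) (Or.inr h)⟩
      obtain ⟨r, hr, h2⟩ : ∃ r, r < p ∧ Q (Set.Ioo r p) := by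
        rcases hE _ (isPlace_nhdsLT p) with h | h <;>
          obtain ⟨q, hq, h⟩ := mem_nhdsLT_iff_exists_Ioo_subset.1 h
        · exact ⟨q, hq, hconst _ (by simp only [Set.mem_Ioo]; fun_prop) (Or.inl h)⟩
        · exact ⟨q, hq, hconst _ (by simp only [Set.mem_Ioo]; fun_prop) (Or.inr h)⟩
      have h3 : Q {p} := by
        refine hconst _ (by simp only [Set.mem_singleton_iff]; fun_prop) ?_
        by_cases hp : E p
        · exact Or.inl (Set.singleton_subset_iff.2 hp)
        · exact Or.inr (Set.singleton_subset_iff.2 hp)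
      refine ⟨_, mem_nhdsWithin_of_mem_nhds (Ioo_mem_nhds hr hq),
        hmono _ _ ?_ (hunion _ _ (hunion _ _ h2 h3) h1)⟩
      rintro x ⟨hx1, hx2⟩
      rcases lt_trichotomy x p with h | h | h
      · exact Or.inl (Or.inl ⟨hx1, h⟩)
      · exact Or.inl (Or.inr h)
      · exact Or.inr ⟨h, hx2⟩
  obtain ⟨t, ht, -, h⟩ := hunion _ _ (hunion _ _ hM hM') hIcc
  refine h.congr fun x => ⟨fun hx => ⟨hx, ht _ ?_⟩, fun hx => hx.1⟩
  by_cases h1 : x 0 < M'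
  · exact Or.inl (Or.inr h1)
  · by_cases h2 : M < x 0
    · exact Or.inl (Or.inl h2)
    · exact Or.inr ⟨not_lt.1 h1, not_lt.1 h2⟩

theorem IsPlace.eventually_notMem_of_finite (hl : IsPlace l) {E : Set ℝ} (hE : E.Finite) :
    ∀ᶠ x in l, x ∉ E := by
  have h : ∀ y ∈ E, ∀ᶠ x in l, x ≠ y := by
    intro y _
    refine (hl.mem_or_compl_mem_of_ordConnected (Set.ordConnected_singleton (a := y))).resolve_left ?_
    intro h
    obtain ⟨J, hJ, hJl, hJs⟩ := hl.exists_isOpenInterval h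
    have := hl.neBot
    obtain ⟨x, hx⟩ := nonempty_of_mem hJl
    have hnear : ∀ᶠ z in 𝓝[≠] x, z ∈ J := mem_nhdsWithin_of_mem_nhds (hJ.1.mem_nhds hx)
    obtain ⟨z, hz, hz'⟩ := (hnear.and self_mem_nhdsWithin).exists
    exact hz' ((hJs hz).trans (hJs hx).symm)
  filter_upwards [(eventually_all_finite hE).2 h] with x hx hxE
  exact hx x hxE rfl

/-- Conditions on the values of a chain on `I` define a definable subset of `I`. -/
theorem IsPfaffianChainOn.defPred {f : Fin n → ℝ → ℝ} (hf : IsPfaffianChainOn L I f)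
    (hI : IsOpenInterval I) {D : (Fin (n + 1) → ℝ) → Prop} (hD : DefPred L D) :
    DefPred L fun x : Fin 1 → ℝ => x 0 ∈ I ∧ D (chainTuple f (x 0)) := by
  refine defPred_of_forall_isPlace (L := L) (E := fun x => x ∈ I ∧ D (chainTuple f x))
    fun l hl => ?_
  rcases hl.mem_or_compl_mem_of_ordConnected hI.2 with h | h
  · refine (hf.decided hl h D hD).imp (fun h' => ?_) fun h' => ?_
    · filter_upwards [h, h'] with x hx hx' using ⟨hx, hx'⟩
    · filter_upwards [h'] with x hx' using fun h => hx' h.2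
  · right
    filter_upwards [h] with x hx using fun h => hx h.1

/-- A function of a chain that satisfies a nontrivial polynomial equation over the preceding ones
is definable from them near every place, and from them and `x` on the whole interval. -/
theorem IsPfaffianChainOn.exists_defFn_of_polynomial {f : Fin n → ℝ → ℝ}
    (hf : IsPfaffianChainOn L I f) (hI : IsOpenInterval I) (hl : IsPlace l) (hIl : I ∈ l)
    (i : Fin n) {d : ℕ} {c : ℕ → (Fin i.val → ℝ) → ℝ} (hc : ∀ j, DefFn L (c j))
    (han : ∀ j, AnalyticOnNhd ℝ (fun x => c j fun r => f (r.castLE i.isLt.le) x) I)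
    (hpoly : ∀ x ∈ I, ∑ j ∈ Finset.range (d + 1),
      c j (fun r => f (r.castLE i.isLt.le) x) * f i x ^ j = 0)
    (hne : ∃ j ∈ Finset.range (d + 1), ∃ x ∈ I, c j (fun r => f (r.castLE i.isLt.le) x) ≠ 0) :
    (∃ F : (Fin i.val → ℝ) → ℝ, DefFn L F ∧
      ∀ᶠ x in l, f i x = F fun r : Fin i.val => f (r.castLE i.isLt.le) x) ∧
    ∃ F : (Fin (i.val + 1) → ℝ) → ℝ, DefFn L F ∧
      ∀ x ∈ I, f i x = F (Fin.cons x fun r : Fin i.val => f (r.castLE i.isLt.le) x) := by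
  classical
  set b : ℝ → Fin i.val → ℝ := fun x r => f (r.castLE i.isLt.le) x with hb
  set T : (Fin i.val → ℝ) → Prop := fun b => ∀ j : Fin (d + 1), c j b = 0 with hT
  have hTdef : DefPred L T := by
    have := fun j : Fin (d + 1) => hc j
    fun_prop
  set D : (Fin (i.val + 1) → ℝ) → Prop := fun w => ¬ T (Fin.init w) ∧
    ∑ j ∈ Finset.range (d + 1), c j (Fin.init w) * w (Fin.last _) ^ j = 0 with hD
  have hDdef : DefPred L D := by fun_prop
  have hfib : ∀ b, (fiber D b).Finite ∧ (fiber D b).ncard ≤ d := by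
    intro b
    by_cases hTb : T b
    · have : fiber D b = ∅ := by
        ext y; simp [fiber, hD, hTb]
      simp [this]
    · set P : Polynomial ℝ := ∑ j ∈ Finset.range (d + 1),
        Polynomial.C (c j b) * Polynomial.X ^ j with hP
      have hP0 : P ≠ 0 := by
        intro hP0
        refine hTb fun j => ?_
        have := congrArg (fun Q => Polynomial.coeff Q j) hP0
        simpa [hP, Polynomial.finsetSum_coeff, Polynomial.coeff_C_mul, Polynomial.coeff_X_pow,
          j.isLt] using this
      have hsub : fiber D b ⊆ P.roots.toFinset := by
        intro y hy
        have hy' : D (Fin.snoc b y) := hy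
        simp only [hD, Fin.init_snoc, Fin.snoc_last] at hy'
        rw [Finset.mem_coe, Multiset.mem_toFinset, Polynomial.mem_roots hP0, Polynomial.IsRoot]
        simp [hP, Polynomial.eval_finsetSum, hy'.2]
      refine ⟨(Finset.finite_toSet _).subset hsub, ?_⟩
      refine (Set.ncard_le_ncard hsub (Finset.finite_toSet _)).trans ?_
      rw [Set.ncard_coe_finset]
      refine (Multiset.toFinset_card_le _).trans ((Polynomial.card_roots' P).trans ?_)
      refine Polynomial.natDegree_sum_le_of_forall_le _ _ fun j hj => ?_
      exact (Polynomial.natDegree_C_mul_X_pow_le _ _).trans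
        (Nat.lt_succ_iff.1 (Finset.mem_range.1 hj))
  have hETdef : DefPred L fun x : Fin 1 → ℝ => x 0 ∈ I ∧ T (b (x 0)) :=
    hf.defPred hI (D := fun w => T fun r => w (r.castLE i.isLt.le : Fin n).succ) (by fun_prop)
  -- If infinite, this definable set would contain an interval; by the identity theorem all
  -- coefficients would then vanish on `I`.
  have hETfin : {x | x ∈ I ∧ T (b x)}.Finite := by
    refine (finite_or_exists_Ioo_subset (L := L) (s := fun x => x ∈ I ∧ T (b x))
      hETdef).resolve_right ?_
    rintro ⟨p, q, hpq, h⟩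
    obtain ⟨z, hz⟩ := exists_between hpq
    obtain ⟨j, hj, x, hx, hjx⟩ := hne
    refine hjx ((han j).eqOn_zero_of_preconnected_of_eventuallyEq_zero hI.2.isPreconnected
      (h z hz).1 ?_ hx)
    filter_upwards [Ioo_mem_nhds hz.1 hz.2] with t ht
    exact (h t ht).2 ⟨j, Finset.mem_range.1 hj⟩
  have hnth := fun j => defFn_nthFiber hDdef j
  set E : ℕ → ℝ → Prop := fun j x => x ∈ I ∧ f i x = nthFiber D j (b x) with hE
  have hEdef : ∀ j, DefPred L fun x : Fin 1 → ℝ => E j (x 0) := by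
    intro j
    have := hnth j
    exact hf.defPred hI (D := fun w => w i.succ =
      nthFiber D j fun r => w (r.castLE i.isLt.le : Fin n).succ) (by fun_prop)
  have hcover : ∀ x ∈ I, ¬ T (b x) → ∃ j < d, E j x := by
    intro x hx hTx
    have hmem : f i x ∈ fiber D (b x) := by
      change D _
      simp only [hD, Fin.init_snoc, Fin.snoc_last]
      exact ⟨hTx, hpoly x hx⟩
    obtain ⟨j, hj, hj'⟩ := (mem_fiber_iff (hfib _).1 _).1 hmem
    exact ⟨j, hj.trans_le (hfib _).2, hx, hj'⟩
  constructor
  · by_contra hcon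
    -- Near the place the exceptional points are avoided and the rank of the root is eventually
    -- fixed, so a single enumerating function suffices and `x` is not needed.
    have hnot : ∀ j ∈ Finset.range d, ∀ᶠ x in l, ¬ E j x := by
      intro j _
      refine (hl.eventually_or_eventually_not (hEdef j)).resolve_left fun h => hcon ?_
      exact ⟨nthFiber D j, hnth j, h.mono fun x hx => hx.2⟩
    rw [← eventually_all_finset] at hnot
    have := hl.neBot
    obtain ⟨x, ⟨hx, hxT⟩, hxI⟩ :=
      ((hnot.and (hl.eventually_notMem_of_finite hETfin)).and hIl).exists
    obtain ⟨j, hj, hjx⟩ := hcover x hxI fun h => hxT ⟨hxI, h⟩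
    exact hx j (Finset.mem_range.2 hj) hjx
  · obtain ⟨F, hF, hF'⟩ := exists_defFn_of_forall_exists hEdef hnth (y := f i) (b := b)
      (fun j x hx => hx.2) d
    have hET : DefPred L fun w : Fin (i.val + 1) → ℝ => w 0 ∈ I ∧ T (b (w 0)) :=
      hETdef.comp (g := fun w _ => w 0) fun _ => DefFn.proj 0
    -- At the finitely many points where all coefficients vanish the equation says nothing, so the
    -- values of `f i` are tabulated as constants. Elsewhere `x` selects the rank of the root.
    refine ⟨fun w => if w 0 ∈ I ∧ T (b (w 0)) then
      ∑ e ∈ hETfin.toFinset, if w 0 = e then f i e else 0 else F w, ?_, fun x hx => ?_⟩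
    · have hs : DefFn L fun w : Fin (i.val + 1) → ℝ =>
          ∑ e ∈ hETfin.toFinset, if w 0 = e then f i e else 0 := by
        refine DefFn.sum _ fun e => ?_
        convert DefFn.ite (L := L) (P := fun w : Fin (i.val + 1) → ℝ => w 0 = e) (by fun_prop)
          (DefFn.const (f i e)) (DefFn.const 0)
      convert DefFn.ite hET hs hF
    · by_cases hTx : T (b x)
      · have hmem : x ∈ hETfin.toFinset := by simp [hx, hTx]
        simp only [Fin.cons_zero, hx, hTx, and_self, if_true, Finset.sum_ite_eq, hmem]
      · simp only [Fin.cons_zero, hTx, and_false, if_false]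
        exact hF' x (hcover x hx hTx)

theorem exists_defFn_of_mem_adjoin {m : ℕ} {y : Fin m → ℝ → ℝ}
    (hy : ∀ r, AnalyticOnNhd ℝ (y r) I) {w : I → ℝ}
    (hw : w ∈ Algebra.adjoin ℝ (Set.range fun (r : Fin m) (x : I) => y r x)) :
    ∃ c : (Fin m → ℝ) → ℝ, DefFn L c ∧ AnalyticOnNhd ℝ (fun x => c fun r => y r x) I ∧
      ∀ x : I, w x = c fun r => y r x := by
  induction hw using Algebra.adjoin_induction with
  | mem w hw =>
    obtain ⟨r, rfl⟩ := hw
    exact ⟨fun v => v r, DefFn.proj r, hy r, fun x => rfl⟩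
  | algebraMap a => exact ⟨fun _ => a, DefFn.const a, analyticOnNhd_const, fun x => rfl⟩
  | add w w' _ _ h h' =>
    obtain ⟨c, hc, han, hcw⟩ := h
    obtain ⟨c', hc', han', hcw'⟩ := h'
    exact ⟨fun v => c v + c' v, hc.add hc', han.add han', fun x => by
      rw [Pi.add_apply, hcw, hcw']⟩
  | mul w w' _ _ h h' =>
    obtain ⟨c, hc, han, hcw⟩ := h
    obtain ⟨c', hc', han', hcw'⟩ := h'
    exact ⟨fun v => c v * c' v, hc.mul hc', han.mul han', fun x => by
      rw [Pi.mul_apply, hcw, hcw']⟩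

/-- An algebraic relation would make `g i` removable. Its definition on `I` keeps the remaining
functions a chain there, and its definition near the place, free of `x`, keeps the extension
unchanged. -/
theorem IsMinimalChainOn.transcendental (hI : IsOpenInterval I) (hl : IsPlace l) (hIl : I ∈ l)
    {g : Fin n → ℝ → ℝ} (hg : IsMinimalChainOn L I l g) (i : Fin n) :
    Transcendental (Algebra.adjoin ℝ (Set.range fun (r : Fin i.val) (x : I) =>
      g (r.castLE i.isLt.le) x)) (fun x : I => g i x) := by
  obtain ⟨hchain, hmin⟩ := hg
  rintro ⟨P, hP, hPg⟩
  choose c hc han hcw using fun j => exists_defFn_of_mem_adjoin (L := L) (I := I)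
    (y := fun r : Fin i.val => g (r.castLE i.isLt.le)) (fun r => hchain.1 _) (P.coeff j).2
  have hpoly : ∀ x ∈ I, ∑ j ∈ Finset.range (P.natDegree + 1),
      c j (fun r => g (r.castLE i.isLt.le) x) * g i x ^ j = 0 := by
    intro x hx
    rw [Polynomial.aeval_eq_sum_range] at hPg
    have := congrFun hPg ⟨x, hx⟩
    rw [Finset.sum_apply] at this
    refine Eq.trans (Finset.sum_congr rfl fun j _ => ?_) this
    rw [← hcw j ⟨x, hx⟩]
    rfl
  have hne : ∃ j ∈ Finset.range (P.natDegree + 1), ∃ x ∈ I,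
      c j (fun r => g (r.castLE i.isLt.le) x) ≠ 0 := by
    refine ⟨P.natDegree, Finset.self_mem_range_succ _, ?_⟩
    by_contra! hcon
    refine Polynomial.leadingCoeff_ne_zero.2 hP (Subtype.ext (funext fun x => ?_))
    exact (hcw P.natDegree x).trans (hcon x x.2)
  obtain ⟨⟨F, hF, hFl⟩, F', hF', hFI⟩ :=
    hchain.exists_defFn_of_polynomial hI hl hIl i hc han hpoly hne
  cases n with
  | zero => exact i.elim0
  | succ n =>
    have := hmin n _ (hchain.comp_succAbove i hF' hFI) (ext_comp_succAbove i hF hFl)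
    omega

theorem algebraicIndependent_of_transcendental_prefix {A : Type*} [CommRing A] [Algebra ℝ A]
    [Nontrivial A] {y : Fin n → A} (h : ∀ i : Fin n, Transcendental (Algebra.adjoin ℝ
      (Set.range fun r : Fin i.val => y (r.castLE i.isLt.le))) (y i)) :
    AlgebraicIndependent ℝ y := by
  induction n with
  | zero => exact algebraicIndependent_empty_type_iff.2 (algebraMap ℝ A).injective
  | succ n ih =>
    have h1 := ih (y := fun i => y i.castSucc) fun i => h i.castSucc
    have h2 := (h1.option_iff_transcendental (y (Fin.last n))).2 (h (Fin.last n))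
    rw [← algebraicIndependent_equiv finSuccEquivLast.symm]
    convert h2 using 1
    ext o
    cases o <;> simp

theorem IsMinimalChainOn.trdeg_adjoin (hI : IsOpenInterval I) (hl : IsPlace l) (hIl : I ∈ l)
    {g : Fin n → ℝ → ℝ} (hg : IsMinimalChainOn L I l g) :
    Algebra.trdeg ℝ (Algebra.adjoin ℝ (Set.range fun (i : Fin n) (x : I) => g i x)) = n := by
  have := hl.neBot
  have : Nonempty I := (nonempty_of_mem hIl).to_subtype
  have hind : AlgebraicIndependent ℝ fun (i : Fin n) (x : I) => g i x :=
    algebraicIndependent_of_transcendental_prefix (hg.transcendental hI hl hIl)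
  -- By independence the algebra is a polynomial ring in `n` variables.
  rw [← hind.aevalEquiv.trdeg_eq, MvPolynomial.trdeg_of_isDomain]
  simp

end Global

/-- In a family of tuples there is a shortest one among those with a given invariant. -/
theorem exists_minimal_length {A B : Type*} {P : ∀ {k : ℕ}, (Fin k → A) → Prop}
    {e : ∀ {k : ℕ}, (Fin k → A) → B} {n : ℕ} {f : Fin n → A} (hf : P f) :
    ∃ (m : ℕ) (g : Fin m → A),
      (P g ∧ ∀ (k : ℕ) (h : Fin k → A), P h → e h = e g → m ≤ k) ∧ e f = e g := by
  classical
  have hex : ∃ m, ∃ g : Fin m → A, P g ∧ e f = e g := ⟨n, f, hf, rfl⟩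
  obtain ⟨g, hg, hgf⟩ := Nat.find_spec hex
  exact ⟨_, g, ⟨hg, fun k h hh hhg => Nat.find_min' hex ⟨h, hh, hgf.trans hhg.symm⟩⟩, hgf⟩

end Pfaff

theorem mainTheorem8 (L : FirstOrder.Language.{u, v}) [L.Structure ℝ]
    (hL : Pfaff.IsOMinimalExpansion L)
    (I : Set ℝ) (hI : Pfaff.IsOpenInterval I)
    (l : Filter ℝ) (hl : Pfaff.IsPlace l) (hIl : I ∈ l)
    (n : ℕ) (f : Fin n → ℝ → ℝ) (hf : Pfaff.IsPfaffianChainOn L I f) :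
    ((∃ (m : ℕ) (g : Fin m → ℝ → ℝ),
        Pfaff.IsMinimalChainAt L l g ∧ Pfaff.ext L l f = Pfaff.ext L l g) ∧
      ∀ (m : ℕ) (g : Fin m → ℝ → ℝ),
        Pfaff.IsMinimalChainAt L l g → Pfaff.ext L l f = Pfaff.ext L l g →
          Pfaff.dclTrdeg L l (Pfaff.ext L l g) = m) ∧
    ((∃ (m : ℕ) (g : Fin m → ℝ → ℝ),
        Pfaff.IsMinimalChainOn L I l g ∧ Pfaff.ext L l f = Pfaff.ext L l g) ∧
      ∀ (m : ℕ) (g : Fin m → ℝ → ℝ),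
        Pfaff.IsMinimalChainOn L I l g → Pfaff.ext L l f = Pfaff.ext L l g →
          Algebra.trdeg ℝ (Algebra.adjoin ℝ (Set.range fun (i : Fin m) (x : I) => g i x)) = m) := by
  have : Fact (Pfaff.IsOMinimalExpansion L) := ⟨hL⟩
  refine ⟨⟨?_, fun m g hg _ => hg.dclTrdeg_ext hl⟩, ?_, fun m g hg _ => hg.trdeg_adjoin hI hl hIl⟩
  · exact Pfaff.exists_minimal_length (P := fun {k} h => Pfaff.IsPfaffianChainAt L l h)
      (e := fun {k} h => Pfaff.ext L l h) ⟨I, hI, hIl, hf⟩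
  · exact Pfaff.exists_minimal_length (P := fun {k} h => Pfaff.IsPfaffianChainOn L I h)
      (e := fun {k} h => Pfaff.ext L l h) hf
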